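/- There are universal constants $C_1,C_2,C_3>0$ such that the following holds. Let $1\le r\le n$ and $m$ be integers, let $0<\rho<1$, and suppose that $m\ge C_1\rho^{-2}nr$. Let $a_1,\dots,a_m$ be independent complex standard Gaussian vectors in $\mathbb{C}^n$ (the coordinates are independent, and their real and imaginary parts are independent centred Gaussians of variance $1/2$), and let $\mathcal{A}:\mathbb{C}^{n\times n}\to\mathbb{C}^m$ be the measurement map $\mathcal{A}(Z)=\big(\operatorname{tr}(ZA_j^*)\big)_{j=1}^m$ with $A_j=a_ja_j^*$. Then with probability at least $1-e^{-C_2m}$ the following holds simultaneously for all Hermitian matrices $X\in\mathbb{C}^{n\times n}$, all $\eta\ge 0$ and all $\epsilon\in\mathbb{C}^m$ with $\|\epsilon\|_{\ell_2}\le\eta$. Put $b=\mathcal{A}(X)+\epsilon$. Every solution $X^\sharp$ of $$\min_{Z\in\mathbb{C}^{n\times n},\ Z=Z^*}\|Z\|_*\quad\text{subject to}\quad\|\mathcal{A}(Z)-b\|_{\ell_2}\le\eta$$ satisfies $$\|X-X^\sharp\|_F\le\frac{2(1+\rho)^2}{(1-\rho)\sqrt r}\,\|X_c\|_*+\frac{(3+\rho)C_3}{1-\rho}\cdot\frac{\eta}{\sqrt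 m}.$$ Here $\|\cdot\|_F$ is the Frobenius norm, $\|\cdot\|_*$ is the nuclear norm (the sum of the singular values $\sigma_1\ge\dots\ge\sigma_n$), and $\|X_c\|_*=\sum_{j=r+1}^n\sigma_j(X)$ is the nuclear norm of $X_c=\sum_{j=r+1}^n\sigma_j(X)u_jv_j^*$, where $X=\sum_{j=1}^n\sigma_j(X)u_jv_j^*$ is a singular value decomposition. In particular, if $\eta=0$ and $X$ has rank at most $r$, then $X$ is the unique solution. -/

import Mathlib

open MeasureTheory ProbabilityTheory
open scoped Matrix

namespace LowRankRecovery

/-- The standard complex Gaussian distribution on `ℂ`: the law of `g + i h` with `g`, `h`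
independent real centred Gaussians of variance `1/2`, so that `E |z| ^ 2 = 1`. -/
noncomputable def stdComplexGaussian : Measure ℂ :=
  ((gaussianReal 0 (1 / 2)).prod (gaussianReal 0 (1 / 2))).map Complex.measurableEquivRealProd.symm

/-- The law of a complex standard Gaussian vector in `ℂⁿ`: the coordinates are independent
standard complex Gaussians. -/
noncomputable def stdComplexGaussianVector (n : ℕ) : Measure (Fin n → ℂ) :=
  Measure.pi fun _ => stdComplexGaussian

/-- The matrix `a a^*`, with entries `a_k * conj a_l`. -/
def rankOne {n : ℕ} (a : Fin n → ℂ) : Matrix (Fin n) (Fin n) ℂ :=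
  Matrix.vecMulVec a (star a)

/-- The measurement map `Z ↦ ∑ j, tr (Z A_j^*) e_j` with values in `ℂᵐ` (with the `ℓ²` norm). -/
noncomputable def measurementMap {n m : ℕ} (A : Fin m → Matrix (Fin n) (Fin n) ℂ)
    (Z : Matrix (Fin n) (Fin n) ℂ) : EuclideanSpace ℂ (Fin m) :=
  WithLp.toLp 2 fun j => (Z * (A j)ᴴ).trace

/-- The singular values of a matrix in non-increasing order, counted from `0`
(and equal to `0` from index `n` on). -/
noncomputable def singularValue {n : ℕ} (X : Matrix (Fin n) (Fin n) ℂ) (j : ℕ) : ℝ :=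
  (Matrix.toEuclideanLin X).singularValues j

/-- The nuclear norm: the sum of all singular values. -/
noncomputable def nuclearNorm {n : ℕ} (X : Matrix (Fin n) (Fin n) ℂ) : ℝ :=
  ∑ j ∈ Finset.range n, singularValue X j

/-- The nuclear norm `‖X_c‖_*` of the remainder `X_c` of `X` after its best rank-`r`
approximation: the sum of all singular values except the `r` largest ones. -/
noncomputable def nuclearTail {n : ℕ} (r : ℕ) (X : Matrix (Fin n) (Fin n) ℂ) : ℝ :=
  ∑ j ∈ Finset.Ico r n, singularValue X j

/-- The Frobenius norm `√(tr (X^* X))`. -/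
noncomputable def frobeniusNorm {n : ℕ} (X : Matrix (Fin n) (Fin n) ℂ) : ℝ :=
  √ (Xᴴ * X).trace.re

/-- `Z` is a solution (a minimizer) of the Hermitian noise-constrained nuclear norm minimization
problem: minimize `‖Z‖_*` over Hermitian `Z` subject to `‖𝒜(Z) - b‖ ≤ η`. -/
structure IsMinimizer {n m : ℕ} (A : Fin m → Matrix (Fin n) (Fin n) ℂ)
    (b : EuclideanSpace ℂ (Fin m)) (η : ℝ) (Z : Matrix (Fin n) (Fin n) ℂ) : Prop where
  isHermitian : Z.IsHermitian
  feasible : ‖measurementMap A Z - b‖ ≤ η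
  minimal : ∀ W : Matrix (Fin n) (Fin n) ℂ, W.IsHermitian → ‖measurementMap A W - b‖ ≤ η →
    nuclearNorm Z ≤ nuclearNorm W

end LowRankRecovery

open LowRankRecovery

/-! The proof establishes a null space property for the measurements and then uses only optimality
of the minimizer.

Since `a^* Z a` has mean `tr Z`, the trace would spoil any two-sided comparison of the measurements
with the Frobenius norm. The vectors are therefore paired, and only the differences `a^* Z a - b^* Z
b` are used. By unitary invariance such a difference is a combination, weighted by the eigenvalues
`d i` of `Z`, of independent symmetric variables; its transform is `∏ (1 - w² d i²)⁻¹`, which is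
controlled by `∑ d i² = ‖Z‖_F²` alone. Chernoff bounds (`measureReal_sum_abs_quadDiff_ge`,
`measureReal_sum_abs_quadDiff_le`) and a net (`exists_net`) show that, with high probability, the
`ℓ¹` norm of the paired measurements is comparable to `‖Z‖_F` on all Hermitian matrices of rank at
most `R`, where `R` is of order `ρ⁻² r`, capped at `n` (`restricted_isometry_of_net`).

Cutting a Hermitian matrix `M` into blocks of `R` singular values gives a dichotomy
(`nullSpace_dichotomy_of_restricted_isometry`): either the `r` leading singular values of `M` are
dominated by the tail, or `‖M‖_F` is bounded by the measurements. Apply it to `M = X - Z` with `Z` a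
minimizer. In the second case feasibility bounds the error by a multiple of `η / √m`. In the first,
`‖Z‖_* ≤ ‖X‖_*` together with the Lipschitz estimate `nuclearTail_sub_nuclearHead_sub_le`, a
consequence of Weyl monotonicity, bounds the tail of `M` by that of `X`. -/

namespace LowRankRecovery

/-! ### Complex Gaussian vectors: unitary invariance and transforms of Hermitian forms. -/

section Gaussian

theorem integral_cexp_mul_sq_gaussianReal {w : ℂ} (hw : w.re < 1) :
    ∫ x, Complex.exp (w * (x : ℂ) ^ 2) ∂(gaussianReal 0 (1 / 2)) =
      ((√Real.pi : ℝ) : ℂ)⁻¹ * (Real.pi / (1 - w)) ^ (1 / 2 : ℂ) := by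
  rw [integral_gaussianReal_eq_integral_smul (by norm_num)]
  have h : ∀ x : ℝ, gaussianPDFReal 0 (1 / 2) x • Complex.exp (w * (x : ℂ) ^ 2) =
      ((√Real.pi : ℝ) : ℂ)⁻¹ * Complex.exp (-(1 - w) * (x : ℂ) ^ 2) := by
    intro x
    rw [gaussianPDFReal, Complex.real_smul]
    push_cast
    rw [mul_assoc, ← Complex.exp_add]
    congr 2
    · norm_num
      rw [mul_right_comm, mul_inv_cancel₀ (by simp), one_mul]
    · ring
  simp_rw [h]
  rw [integral_const_mul, integral_gaussian_complex (by simpa using hw)]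

/-- The real and imaginary parts contribute the same principal square root, so only its square
appears and no choice of branch matters. -/
theorem integral_cexp_mul_normSq_stdComplexGaussian {w : ℂ} (hw : w.re < 1) :
    ∫ z, Complex.exp (w * (Complex.normSq z : ℂ)) ∂stdComplexGaussian = (1 - w)⁻¹ := by
  rw [stdComplexGaussian, integral_map_equiv]
  have h : ∀ p : ℝ × ℝ, Complex.exp (w * (Complex.normSq
      (Complex.measurableEquivRealProd.symm p) : ℂ)) =
      Complex.exp (w * (p.1 : ℂ) ^ 2) * Complex.exp (w * (p.2 : ℂ) ^ 2) := by
    intro p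
    rw [← Complex.exp_add]
    congr 1
    simp [Complex.normSq_apply]
    ring
  simp_rw [h]
  rw [integral_prod_mul (fun x : ℝ => Complex.exp (w * (x : ℂ) ^ 2))
    (fun x : ℝ => Complex.exp (w * (x : ℂ) ^ 2)), integral_cexp_mul_sq_gaussianReal hw]
  have hw' : (1 - w) ≠ 0 := by
    intro h0
    have := congrArg Complex.re h0
    simp at this
    linarith
  have hpi : (Real.pi : ℂ) ≠ 0 := by exact_mod_cast Real.pi_ne_zero
  have h2 : ((Real.pi / (1 - w) : ℂ) ^ (1 / 2 : ℂ)) ^ 2 = Real.pi / (1 - w) := by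
    rw [one_div]
    exact_mod_cast Complex.cpow_nat_inv_pow (Real.pi / (1 - w)) (two_ne_zero)
  have h3 : ((√Real.pi : ℝ) : ℂ) ^ 2 = Real.pi := by
    rw [← Complex.ofReal_pow, Real.sq_sqrt Real.pi_pos.le]
  calc _ = (((√Real.pi : ℝ) : ℂ) ^ 2)⁻¹ * ((Real.pi / (1 - w) : ℂ) ^ (1 / 2 : ℂ)) ^ 2 := by ring
    _ = _ := by rw [h2, h3]; field_simp

instance : IsProbabilityMeasure stdComplexGaussian := by
  unfold stdComplexGaussian
  exact Measure.isProbabilityMeasure_map (MeasurableEquiv.measurable _).aemeasurable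

instance (n : ℕ) : IsProbabilityMeasure (stdComplexGaussianVector n) := by
  unfold stdComplexGaussianVector
  infer_instance

theorem charFun_stdComplexGaussian (t : ℂ) :
    charFun stdComplexGaussian t = Complex.exp (-((‖t‖ ^ 2 / 4 : ℝ) : ℂ)) := by
  rw [charFun_apply, stdComplexGaussian, integral_map_equiv]
  have h : ∀ p : ℝ × ℝ, Complex.exp ((inner ℝ (Complex.measurableEquivRealProd.symm p) t : ℝ) *
      Complex.I) = Complex.exp (t.re * p.1 * Complex.I) * Complex.exp (t.im * p.2 * Complex.I) := by
    intro p
    rw [← Complex.exp_add]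
    congr 1
    simp [Complex.inner]
    ring
  simp_rw [h]
  rw [integral_prod_mul (fun x : ℝ => Complex.exp (t.re * x * Complex.I))
    (fun x : ℝ => Complex.exp (t.im * x * Complex.I)), ← charFun_apply_real, ← charFun_apply_real,
    charFun_gaussianReal, charFun_gaussianReal, ← Complex.exp_add]
  congr 1
  rw [← Complex.normSq_eq_norm_sq, Complex.normSq_apply]
  push_cast
  simp
  ring

theorem charFun_stdComplexGaussianVector {n : ℕ} (t : EuclideanSpace ℂ (Fin n)) :
    charFun ((stdComplexGaussianVector n).map (WithLp.toLp 2)) t =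
      Complex.exp (-((‖t‖ ^ 2 / 4 : ℝ) : ℂ)) := by
  rw [stdComplexGaussianVector, charFun_pi]
  simp_rw [charFun_stdComplexGaussian]
  rw [← Complex.exp_sum, EuclideanSpace.norm_sq_eq]
  congr 1
  push_cast
  rw [Finset.sum_neg_distrib, Finset.sum_div]

/-- The law of a standard complex Gaussian vector is invariant under unitary matrices. -/
theorem map_mulVec_stdComplexGaussianVector {n : ℕ} (U : Matrix (Fin n) (Fin n) ℂ)
    (hU : Uᴴ * U = 1) :
    (stdComplexGaussianVector n).map (fun a => Uᴴ *ᵥ a) = stdComplexGaussianVector n := by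
  have hinj : Function.Injective (fun μ : Measure (Fin n → ℂ) =>
      μ.map (MeasurableEquiv.toLp 2 (Fin n → ℂ))) :=
    (MeasurableEquiv.toLp 2 (Fin n → ℂ)).map_measurableEquiv_injective
  apply hinj
  have hmeas : Measurable (fun a : Fin n → ℂ => Uᴴ *ᵥ a) := by
    have : Continuous (fun a : Fin n → ℂ => Uᴴ *ᵥ a) := by fun_prop
    exact this.measurable
  have := Measure.isProbabilityMeasure_map (μ := stdComplexGaussianVector n) hmeas.aemeasurable
  have := Measure.isProbabilityMeasure_map (μ := stdComplexGaussianVector n)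
    (MeasurableEquiv.toLp 2 (Fin n → ℂ)).measurable.aemeasurable
  have := Measure.isProbabilityMeasure_map
    (μ := (stdComplexGaussianVector n).map (fun a => Uᴴ *ᵥ a))
    (MeasurableEquiv.toLp 2 (Fin n → ℂ)).measurable.aemeasurable
  apply Measure.ext_of_charFun (E := EuclideanSpace ℂ (Fin n))
  ext t
  have key : ∀ μ : Measure (Fin n → ℂ), ∀ s : EuclideanSpace ℂ (Fin n),
      charFun (μ.map (MeasurableEquiv.toLp 2 (Fin n → ℂ))) s =
      ∫ a, Complex.exp ((inner ℝ (WithLp.toLp 2 a) s : ℝ) * Complex.I) ∂μ := by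
    intro μ s
    rw [charFun_apply, integral_map_equiv]
    rfl
  have hinner : ∀ a b : EuclideanSpace ℂ (Fin n),
      (inner ℝ a b : ℝ) = (star a.ofLp ⬝ᵥ b.ofLp).re := by
    intro a b
    rw [PiLp.inner_apply, dotProduct, Complex.re_sum]
    refine Finset.sum_congr rfl fun i _ => ?_
    simp [Complex.inner]
    ring
  have hnorm : ‖(WithLp.toLp 2 (U *ᵥ t.ofLp) : EuclideanSpace ℂ (Fin n))‖ ^ 2 = ‖t‖ ^ 2 := by
    rw [← real_inner_self_eq_norm_sq, ← real_inner_self_eq_norm_sq, hinner, hinner]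
    simp only
    rw [Matrix.star_mulVec, ← Matrix.dotProduct_mulVec, Matrix.mulVec_mulVec, hU,
      Matrix.one_mulVec]
  have h1 : charFun (((stdComplexGaussianVector n).map (fun a => Uᴴ *ᵥ a)).map
      (MeasurableEquiv.toLp 2 (Fin n → ℂ))) t =
      charFun ((stdComplexGaussianVector n).map (MeasurableEquiv.toLp 2 (Fin n → ℂ)))
        (WithLp.toLp 2 (U *ᵥ t.ofLp)) := by
    rw [key, key, integral_map hmeas.aemeasurable]
    · congr 1
      ext a
      rw [hinner, hinner]
      simp only
      rw [Matrix.star_mulVec, Matrix.conjTranspose_conjTranspose, ← Matrix.dotProduct_mulVec]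
    · apply Continuous.aestronglyMeasurable
      fun_prop
  rw [h1]
  have h2 := charFun_stdComplexGaussianVector (n := n)
  have h3 : (WithLp.toLp 2 : (Fin n → ℂ) → EuclideanSpace ℂ (Fin n)) =
    MeasurableEquiv.toLp 2 (Fin n → ℂ) := rfl
  rw [h3] at h2
  rw [h2, h2, hnorm]

/-- The quadratic form `a ↦ a^* Z a` (real part). -/
noncomputable def quadForm {n : ℕ} (Z : Matrix (Fin n) (Fin n) ℂ) (a : Fin n → ℂ) : ℝ :=
  (star a ⬝ᵥ Z *ᵥ a).re

theorem quadForm_conj_diagonal {n : ℕ} (U : Matrix (Fin n) (Fin n) ℂ) (d : Fin n → ℝ)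
    (a : Fin n → ℂ) :
    quadForm (U * Matrix.diagonal (fun i => (d i : ℂ)) * Uᴴ) a =
      ∑ i, d i * Complex.normSq ((Uᴴ *ᵥ a) i) := by
  have : star a ⬝ᵥ (U * Matrix.diagonal (fun i => (d i : ℂ)) * Uᴴ) *ᵥ a =
      star (Uᴴ *ᵥ a) ⬝ᵥ (Matrix.diagonal (fun i => (d i : ℂ)) *ᵥ (Uᴴ *ᵥ a)) := by
    rw [Matrix.star_mulVec, Matrix.conjTranspose_conjTranspose, ← Matrix.dotProduct_mulVec,
      Matrix.mulVec_mulVec, Matrix.mulVec_mulVec, Matrix.mul_assoc]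
  rw [quadForm, this, dotProduct, Complex.re_sum]
  refine Finset.sum_congr rfl fun i _ => ?_
  rw [Matrix.mulVec_diagonal, Complex.normSq_apply]
  simp
  ring

theorem continuous_quadForm {n : ℕ} (Z : Matrix (Fin n) (Fin n) ℂ) :
    Continuous (quadForm Z) := by
  unfold quadForm
  fun_prop

/-- Unitary invariance removes `U`, and the coordinates factor. The parameter is complex because
real `w` serves the upper tail and `w = I` the lower tail. -/
theorem integral_cexp_quadForm {n : ℕ} (U : Matrix (Fin n) (Fin n) ℂ) (hU : Uᴴ * U = 1)
    (d : Fin n → ℝ) {w : ℂ} (hw : ∀ i, (w * d i).re < 1) :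
    ∫ a, Complex.exp (w * (quadForm (U * Matrix.diagonal (fun i => (d i : ℂ)) * Uᴴ) a : ℂ))
      ∂(stdComplexGaussianVector n) = ∏ i, (1 - w * d i)⁻¹ := by
  have h1 : ∫ a, Complex.exp (w * (quadForm (U * Matrix.diagonal (fun i => (d i : ℂ)) * Uᴴ) a : ℂ))
      ∂(stdComplexGaussianVector n) =
      ∫ a, Complex.exp (w * ((∑ i, d i * Complex.normSq (a i) : ℝ) : ℂ))
      ∂((stdComplexGaussianVector n).map (fun a => Uᴴ *ᵥ a)) := by
    rw [integral_map]
    · simp_rw [quadForm_conj_diagonal]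
    · have : Continuous (fun a : Fin n → ℂ => Uᴴ *ᵥ a) := by fun_prop
      exact this.measurable.aemeasurable
    · apply Continuous.aestronglyMeasurable
      have := Complex.continuous_normSq
      fun_prop
  rw [h1, map_mulVec_stdComplexGaussianVector U hU, stdComplexGaussianVector]
  have h2 : ∀ a : Fin n → ℂ, Complex.exp (w * ((∑ i, d i * Complex.normSq (a i) : ℝ) : ℂ)) =
      ∏ i, Complex.exp (w * d i * (Complex.normSq (a i) : ℂ)) := by
    intro a
    rw [← Complex.exp_sum]
    push_cast
    rw [Finset.mul_sum]
    simp_rw [mul_assoc]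
  simp_rw [h2]
  rw [integral_fintype_prod_eq_prod
    (f := fun i (z : ℂ) => Complex.exp (w * d i * (Complex.normSq z : ℂ)))]
  exact Finset.prod_congr rfl fun i _ => integral_cexp_mul_normSq_stdComplexGaussian (hw i)

end Gaussian

/-! ### Chernoff bounds for sums of absolute paired differences. -/

section Tails

theorem measureReal_le_sum_le_exp {α : Type*} [MeasurableSpace α] (μ : Measure α)
    [IsProbabilityMeasure μ] {k : ℕ} {g : α → ℝ} (hg : Integrable (fun x => Real.exp (g x)) μ)
    {c s : ℝ} (hs : ∫ x, Real.exp (g x) ∂μ ≤ Real.exp s) :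
    (Measure.pi fun _ : Fin k => μ).real {p | c ≤ ∑ j, g (p j)} ≤ Real.exp (k * s - c) := by
  have hint : Integrable (fun p : Fin k → α => ∏ j, Real.exp (g (p j)))
      (Measure.pi fun _ : Fin k => μ) :=
    Integrable.fintype_prod (f := fun _ x => Real.exp (g x)) fun _ => hg
  have hmarkov := mul_meas_ge_le_integral_of_nonneg (μ := Measure.pi fun _ : Fin k => μ)
    (f := fun p : Fin k → α => ∏ j, Real.exp (g (p j)))
    (ae_of_all _ fun p => Finset.prod_nonneg fun j _ => (Real.exp_pos _).le) hint (Real.exp c)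
  have hset : {p : Fin k → α | Real.exp c ≤ ∏ j, Real.exp (g (p j))} =
      {p | c ≤ ∑ j, g (p j)} := by
    ext p
    simp [← Real.exp_sum]
  rw [hset, integral_fintype_prod_eq_prod (f := fun (_ : Fin k) x => Real.exp (g x)),
    Finset.prod_const, Finset.card_univ, Fintype.card_fin] at hmarkov
  have h0 : 0 ≤ ∫ x, Real.exp (g x) ∂μ := integral_nonneg fun _ => (Real.exp_pos _).le
  have h1 := hmarkov.trans (pow_le_pow_left₀ h0 hs k)
  rw [← Real.exp_nat_mul] at h1
  rw [Real.exp_sub, le_div_iff₀ (Real.exp_pos _), mul_comm]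
  exact h1

/-- Trades the non-smooth `exp (-|q|)` for a cosine, whose mean is an explicit value of the
characteristic function. -/
theorem exp_neg_le_cos {t : ℝ} (ht : 0 ≤ t) :
    Real.exp (-t) ≤ 2 / 3 + 1 / 3 * Real.cos t := by
  have hexp : Real.exp (-t) ≤ (1 + t)⁻¹ := by
    rw [Real.exp_neg]
    exact inv_anti₀ (by linarith) (by linarith [Real.add_one_le_exp t])
  have h1 : 1 - Real.cos t ≤ t := by
    have h2 := Real.abs_sin_le_abs (x := t / 2)
    have h3 : Real.cos t = 1 - 2 * Real.sin (t / 2) ^ 2 := by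
      have := Real.cos_two_mul (t / 2)
      have := Real.sin_sq_add_cos_sq (t / 2)
      rw [show 2 * (t / 2) = t by ring] at *
      linarith
    have h4 : |Real.sin (t / 2)| ≤ 1 := Real.abs_sin_le_one _
    rw [abs_of_nonneg (by linarith : 0 ≤ t / 2)] at h2
    rw [h3, ← sq_abs (Real.sin _)]
    nlinarith [abs_nonneg (Real.sin (t / 2))]
  have h2 := Real.neg_one_le_cos t
  refine hexp.trans ?_
  rw [inv_le_iff_one_le_mul₀ (by linarith)]
  nlinarith [Real.cos_le_one t]

theorem one_add_sum_le_prod {ι : Type*} (s : Finset ι) {x : ι → ℝ} (hx : ∀ i, 0 ≤ x i) :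
    1 + ∑ i ∈ s, x i ≤ ∏ i ∈ s, (1 + x i) := by
  classical
  induction s using Finset.induction_on with
  | empty => simp
  | insert a s ha ih =>
    rw [Finset.sum_insert ha, Finset.prod_insert ha]
    have := Finset.sum_nonneg (s := s) fun i _ => hx i
    nlinarith [hx a, mul_nonneg (hx a) this]

theorem one_sub_sum_le_prod {ι : Type*} (s : Finset ι) {x : ι → ℝ} (hx : ∀ i, 0 ≤ x i)
    (hx1 : ∀ i, x i ≤ 1) :
    1 - ∑ i ∈ s, x i ≤ ∏ i ∈ s, (1 - x i) := by
  classical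
  induction s using Finset.induction_on with
  | empty => simp
  | insert a s ha ih =>
    rw [Finset.sum_insert ha, Finset.prod_insert ha]
    have h1 := Finset.sum_nonneg (s := s) fun i _ => hx i
    have h2 := mul_le_mul_of_nonneg_left ih (sub_nonneg.2 (hx1 a))
    nlinarith [hx a, mul_nonneg (hx a) h1]

/-- The difference of the quadratic form at two independent points. -/
noncomputable def quadDiff {n : ℕ} (Z : Matrix (Fin n) (Fin n) ℂ)
    (p : (Fin n → ℂ) × (Fin n → ℂ)) : ℝ :=
  quadForm Z p.1 - quadForm Z p.2

theorem continuous_quadDiff {n : ℕ} (Z : Matrix (Fin n) (Fin n) ℂ) :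
    Continuous (quadDiff Z) := by
  have := continuous_quadForm Z
  unfold quadDiff
  fun_prop

/-- The law of a pair of independent standard complex Gaussian vectors. -/
noncomputable def gaussianPair (n : ℕ) : Measure ((Fin n → ℂ) × (Fin n → ℂ)) :=
  (stdComplexGaussianVector n).prod (stdComplexGaussianVector n)

instance (n : ℕ) : IsProbabilityMeasure (gaussianPair n) := by
  unfold gaussianPair
  infer_instance

variable {n : ℕ} {U : Matrix (Fin n) (Fin n) ℂ} {d : Fin n → ℝ}

/-- Symmetrization pairs the factors `1 - w d i` and `1 + w d i`; the terms linear in `d`, hence the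
trace, cancel. -/
theorem integral_cexp_quadDiff (hU : Uᴴ * U = 1) {w : ℂ} (hw : ∀ i, |(w * d i).re| < 1) :
    ∫ p, Complex.exp (w * (quadDiff (U * Matrix.diagonal (fun i => (d i : ℂ)) * Uᴴ) p : ℂ))
      ∂(gaussianPair n) = ∏ i, (1 - w ^ 2 * d i ^ 2)⁻¹ := by
  set Z := U * Matrix.diagonal (fun i => (d i : ℂ)) * Uᴴ with hZ
  have h : ∀ p : (Fin n → ℂ) × (Fin n → ℂ), Complex.exp (w * (quadDiff Z p : ℂ)) =
      Complex.exp (w * (quadForm Z p.1 : ℂ)) * Complex.exp (-w * (quadForm Z p.2 : ℂ)) := by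
    intro p
    rw [← Complex.exp_add, quadDiff]
    congr 1
    push_cast
    ring
  simp_rw [h]
  rw [gaussianPair, integral_prod_mul (fun a => Complex.exp (w * (quadForm Z a : ℂ)))
    (fun a => Complex.exp (-w * (quadForm Z a : ℂ))), hZ,
    integral_cexp_quadForm U hU d (fun i => (abs_lt.1 (hw i)).2),
    integral_cexp_quadForm U hU d (fun i => by
      have := (abs_lt.1 (hw i)).1
      rw [neg_mul, Complex.neg_re]
      linarith), ← Finset.prod_mul_distrib]
  refine Finset.prod_congr rfl fun i _ => ?_
  rw [← mul_inv]
  congr 1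
  ring

theorem integral_exp_quadDiff (hU : Uᴴ * U = 1) {θ : ℝ} (hθ : ∀ i, |θ * d i| < 1) :
    ∫ p, Real.exp (θ * quadDiff (U * Matrix.diagonal (fun i => (d i : ℂ)) * Uᴴ) p)
      ∂(gaussianPair n) = ∏ i, (1 - θ ^ 2 * d i ^ 2)⁻¹ := by
  have h := integral_cexp_quadDiff (d := d) hU (w := θ) (by
    intro i
    rw [← Complex.ofReal_mul, Complex.ofReal_re]
    exact hθ i)
  have h2 : ∀ p, Complex.exp (θ * (quadDiff (U * Matrix.diagonal (fun i => (d i : ℂ)) * Uᴴ) p : ℂ))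
      = ((Real.exp (θ * quadDiff (U * Matrix.diagonal (fun i => (d i : ℂ)) * Uᴴ) p) : ℝ) : ℂ) := by
    intro p
    push_cast
    rfl
  simp_rw [h2] at h
  rw [integral_complex_ofReal] at h
  exact_mod_cast h

theorem abs_le_one_of_sum_sq_eq_one (hd : ∑ i, d i ^ 2 = 1) (i : Fin n) : |d i| ≤ 1 := by
  have h1 := Finset.single_le_sum (f := fun i => d i ^ 2) (fun i _ => sq_nonneg (d i))
    (Finset.mem_univ i)
  rw [hd] at h1
  exact abs_le_one_iff_mul_self_le_one.2 (by nlinarith)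

theorem integrable_exp_quadDiff (hU : Uᴴ * U = 1) {θ : ℝ} (hθ : ∀ i, |θ * d i| < 1) :
    Integrable (fun p => Real.exp (θ * quadDiff (U * Matrix.diagonal (fun i => (d i : ℂ)) * Uᴴ) p))
      (gaussianPair n) := by
  -- The Bochner integral of a non-integrable function is `0`, so the nonzero closed form already
  -- proves integrability.
  apply Integrable.of_integral_ne_zero
  rw [integral_exp_quadDiff hU hθ]
  refine Finset.prod_ne_zero_iff.2 fun i _ => inv_ne_zero ?_
  have := hθ i
  rw [← sq_lt_one_iff_abs_lt_one, mul_pow] at this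
  linarith

/-- Bounding `exp (|x| / 2)` by the two signed exponentials gives `2 / ∏ (1 - d i² / 4) ≤ 2 · 4/3 <
e`. -/
theorem integrable_and_integral_exp_abs_quadDiff_le (hU : Uᴴ * U = 1) (hd : ∑ i, d i ^ 2 = 1) :
    Integrable (fun p => Real.exp (1 / 2 *
      |quadDiff (U * Matrix.diagonal (fun i => (d i : ℂ)) * Uᴴ) p|)) (gaussianPair n) ∧
    ∫ p, Real.exp (1 / 2 * |quadDiff (U * Matrix.diagonal (fun i => (d i : ℂ)) * Uᴴ) p|)
      ∂(gaussianPair n) ≤ Real.exp 1 := by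
  have hd1 := abs_le_one_of_sum_sq_eq_one hd
  have hp : ∀ i, |(1 / 2 : ℝ) * d i| < 1 := fun i => by
    rw [abs_mul, abs_of_pos (by norm_num : (0 : ℝ) < 1 / 2)]
    linarith [hd1 i]
  have hm : ∀ i, |(-(1 / 2) : ℝ) * d i| < 1 := fun i => by
    rw [neg_mul, abs_neg]
    exact hp i
  have hle : ∀ x : ℝ, Real.exp (1 / 2 * |x|) ≤ Real.exp (1 / 2 * x) + Real.exp (-(1 / 2) * x) := by
    intro x
    rcases abs_cases x with ⟨h, _⟩ | ⟨h, _⟩ <;> rw [h]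
    · linarith [Real.exp_pos (-(1 / 2) * x)]
    · rw [show 1 / 2 * -x = -(1 / 2) * x by ring]
      linarith [Real.exp_pos (1 / 2 * x)]
  have hint := (integrable_exp_quadDiff hU hp).add (integrable_exp_quadDiff hU hm)
  have hint' : Integrable (fun p => Real.exp (1 / 2 *
      |quadDiff (U * Matrix.diagonal (fun i => (d i : ℂ)) * Uᴴ) p|)) (gaussianPair n) := by
    refine hint.mono' ?_ (ae_of_all _ fun p => ?_)
    · apply Continuous.aestronglyMeasurable
      have := continuous_quadDiff (U * Matrix.diagonal (fun i => (d i : ℂ)) * Uᴴ)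
      fun_prop
    · rw [Real.norm_of_nonneg (Real.exp_pos _).le]
      exact hle _
  refine ⟨hint', (integral_mono hint' hint fun p => hle _).trans ?_⟩
  simp only [Pi.add_apply]
  rw [integral_add (integrable_exp_quadDiff hU hp) (integrable_exp_quadDiff hU hm),
    integral_exp_quadDiff hU hp, integral_exp_quadDiff hU hm, Finset.prod_inv_distrib,
    Finset.prod_inv_distrib]
  have hprod : 3 / 4 ≤ ∏ i, (1 - (1 / 2 : ℝ) ^ 2 * d i ^ 2) := by
    have := one_sub_sum_le_prod Finset.univ (x := fun i => (1 / 2 : ℝ) ^ 2 * d i ^ 2)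
      (fun i => by positivity) (fun i => by
        have := (sq_le_one_iff_abs_le_one _).2 (hd1 i)
        nlinarith)
    rw [← Finset.mul_sum, hd] at this
    norm_num at this ⊢
    exact this
  have hinv := inv_anti₀ (by norm_num) hprod
  have he := Real.exp_one_gt_d9
  rw [neg_sq]
  norm_num at hinv ⊢
  linarith

/-- The mean of the cosine is `∏ (1 + d i²)⁻¹ ≤ 1/2`, so the bound is `2/3 + 1/6 = 5/6 ≤ exp
(-1/6)`. -/
theorem integrable_and_integral_exp_neg_abs_quadDiff_le (hU : Uᴴ * U = 1)
    (hd : ∑ i, d i ^ 2 = 1) :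
    Integrable (fun p => Real.exp
      (-|quadDiff (U * Matrix.diagonal (fun i => (d i : ℂ)) * Uᴴ) p|)) (gaussianPair n) ∧
    ∫ p, Real.exp (-|quadDiff (U * Matrix.diagonal (fun i => (d i : ℂ)) * Uᴴ) p|)
      ∂(gaussianPair n) ≤ Real.exp (-(1 / 6)) := by
  have hcont := continuous_quadDiff (U * Matrix.diagonal (fun i => (d i : ℂ)) * Uᴴ)
  have hint : Integrable (fun p => Real.exp
      (-|quadDiff (U * Matrix.diagonal (fun i => (d i : ℂ)) * Uᴴ) p|)) (gaussianPair n) := by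
    refine Integrable.of_bound (C := 1) ?_ (ae_of_all _ fun p => ?_)
    · apply Continuous.aestronglyMeasurable
      fun_prop
    · rw [Real.norm_of_nonneg (Real.exp_pos _).le]
      exact Real.exp_le_one_iff.2 (neg_nonpos.2 (abs_nonneg _))
  have hcos : Integrable (fun p => Real.cos
      (quadDiff (U * Matrix.diagonal (fun i => (d i : ℂ)) * Uᴴ) p)) (gaussianPair n) := by
    refine Integrable.of_bound (C := 1) ?_ (ae_of_all _ fun p => Real.abs_cos_le_one _)
    apply Continuous.aestronglyMeasurable
    fun_prop
  have hcexp : Integrable (fun p => Complex.exp (Complex.I *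
      (quadDiff (U * Matrix.diagonal (fun i => (d i : ℂ)) * Uᴴ) p : ℂ))) (gaussianPair n) := by
    refine Integrable.of_bound (C := 1) ?_ (ae_of_all _ fun p => ?_)
    · apply Continuous.aestronglyMeasurable
      fun_prop
    · rw [mul_comm, Complex.norm_exp_ofReal_mul_I]
  have hval : ∫ p, Real.cos (quadDiff (U * Matrix.diagonal (fun i => (d i : ℂ)) * Uᴴ) p)
      ∂(gaussianPair n) = ∏ i, (1 + d i ^ 2)⁻¹ := by
    have h := integral_cexp_quadDiff (d := d) hU (w := Complex.I) (by
      intro i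
      simp)
    have h2 := congrArg Complex.re h
    rw [← RCLike.re_eq_complex_re, ← integral_re hcexp] at h2
    have h3 : ∀ p, RCLike.re (Complex.exp (Complex.I *
        (quadDiff (U * Matrix.diagonal (fun i => (d i : ℂ)) * Uᴴ) p : ℂ))) =
        Real.cos (quadDiff (U * Matrix.diagonal (fun i => (d i : ℂ)) * Uᴴ) p) := by
      intro p
      rw [RCLike.re_eq_complex_re, mul_comm, Complex.exp_ofReal_mul_I_re]
    simp_rw [h3] at h2
    rw [h2, RCLike.re_eq_complex_re]
    have h4 : ∏ i, (1 - Complex.I ^ 2 * (d i : ℂ) ^ 2)⁻¹ =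
        ((∏ i, (1 + d i ^ 2)⁻¹ : ℝ) : ℂ) := by
      push_cast
      refine Finset.prod_congr rfl fun i _ => ?_
      rw [Complex.I_sq]
      congr 1
      ring
    rw [h4, Complex.ofReal_re]
  refine ⟨hint, ?_⟩
  have hle : ∀ x : ℝ, Real.exp (-|x|) ≤ 2 / 3 + 1 / 3 * Real.cos x := by
    intro x
    rw [← Real.cos_abs x]
    exact exp_neg_le_cos (abs_nonneg x)
  have h1 := integral_mono hint ((integrable_const (2 / 3 : ℝ)).add (hcos.const_mul (1 / 3)))
    fun p => hle _
  refine h1.trans ?_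
  simp only [Pi.add_apply]
  rw [integral_add (integrable_const _) (hcos.const_mul _), integral_const_mul, hval,
    integral_const, Finset.prod_inv_distrib]
  have hprod := one_add_sum_le_prod Finset.univ (x := fun i => d i ^ 2) (fun i => sq_nonneg _)
  rw [hd] at hprod
  have hinv := inv_anti₀ (by norm_num) hprod
  have he := Real.add_one_le_exp (-(1 / 6 : ℝ))
  simp
  norm_num at hinv he ⊢
  linarith

variable (k : ℕ)

theorem measureReal_sum_abs_quadDiff_ge (hU : Uᴴ * U = 1) (hd : ∑ i, d i ^ 2 = 1) :
    (Measure.pi fun _ : Fin k => gaussianPair n).real {p | 4 * (k : ℝ) ≤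
      ∑ j, |quadDiff (U * Matrix.diagonal (fun i => (d i : ℂ)) * Uᴴ) (p j)|} ≤
      Real.exp (-k) := by
  obtain ⟨h1, h2⟩ := integrable_and_integral_exp_abs_quadDiff_le hU hd
  have h3 := measureReal_le_sum_le_exp (k := k) (c := 2 * k) (gaussianPair n) h1 h2
  simp_rw [← Finset.mul_sum] at h3
  convert h3 using 2
  · ext p
    simp only [Set.mem_ofPred_eq]
    constructor <;> intro h <;> linarith
  · ring

theorem measureReal_sum_abs_quadDiff_le (hU : Uᴴ * U = 1) (hd : ∑ i, d i ^ 2 = 1) :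
    (Measure.pi fun _ : Fin k => gaussianPair n).real {p |
      ∑ j, |quadDiff (U * Matrix.diagonal (fun i => (d i : ℂ)) * Uᴴ) (p j)| ≤ k / 12} ≤
      Real.exp (-(k / 12)) := by
  obtain ⟨h1, h2⟩ := integrable_and_integral_exp_neg_abs_quadDiff_le hU hd
  have h3 := measureReal_le_sum_le_exp (k := k) (c := -(k / 12)) (gaussianPair n) h1 h2
  simp_rw [Finset.sum_neg_distrib, neg_le_neg_iff] at h3
  convert h3 using 2
  ring

end Tails

/-! ### Ordered eigenvalues and singular values of symmetric operators. -/

section Eigenvalues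

variable {E : Type*} [NormedAddCommGroup E] [InnerProductSpace ℂ E] [FiniteDimensional ℂ E]
  {n : ℕ}

open Polynomial in
theorem eigenvalues_eq_of_apply_basis {T : E →ₗ[ℂ] E} (hT : T.IsSymmetric)
    (hn : Module.finrank ℂ E = n) (b : Module.Basis (Fin n) ℂ E) {d : Fin n → ℝ}
    (hd : Antitone d) (h : ∀ i, T (b i) = (d i : ℂ) • b i) : hT.eigenvalues hn = d := by
  have hmat : T.toMatrix b b = Matrix.diagonal (fun i => (d i : ℂ)) := by
    ext i j
    rw [LinearMap.toMatrix_apply, h j, map_smul, Matrix.diagonal_apply]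
    simp only [Finsupp.smul_apply, Module.Basis.repr_self, smul_eq_mul, Finsupp.single_apply]
    grind
  have hroots : T.charpoly.roots = Multiset.map (fun i => (d i : ℂ)) Finset.univ.val := by
    rw [← LinearMap.charpoly_toMatrix _ b, hmat, Matrix.charpoly_diagonal,
      Polynomial.roots_prod _ _ (by simp [Finset.prod_ne_zero_iff, Polynomial.X_sub_C_ne_zero])]
    simp
  have hsort : (T.charpoly.roots.map RCLike.re).sort (· ≥ ·) = List.ofFn d := by
    simp_rw [hroots, Fin.univ_val_map, Multiset.map_coe, List.map_ofFn,
      Function.comp_def, RCLike.re_eq_complex_re, Complex.ofReal_re, Multiset.coe_sort]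
    convert! List.mergeSort_of_pairwise ?_
    simp_rw [decide_eq_true_eq, ← List.sortedGE_iff_pairwise]
    exact hd.sortedGE_ofFn
  rw [← List.ofFn_inj, ← hT.sort_roots_charpoly_eq_eigenvalues, hsort]

/-- An eigenbasis of `T` also diagonalizes `T^* T = T²`; sorting it by decreasing `|eigenvalue|`
gives the order used for singular values. -/
theorem exists_perm_abs_eigenvalues_eq_singularValues {T : E →ₗ[ℂ] E} (hT : T.IsSymmetric)
    (hn : Module.finrank ℂ E = n) :
    ∃ σ : Equiv.Perm (Fin n), ∀ j, |hT.eigenvalues hn (σ j)| = T.singularValues j := by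
  set α := hT.eigenvalues hn with hα
  set σ := Tuple.sort (fun i => -|α i|) with hσ
  have hmono : Monotone (fun i => -|α (σ i)|) := Tuple.monotone_sort (fun i => -|α i|)
  have hanti : Antitone (fun i => |α (σ i)| ^ 2) := by
    intro i j hij
    have := hmono hij
    simp only [neg_le_neg_iff] at this
    exact pow_le_pow_left₀ (abs_nonneg _) this 2
  have hadj : LinearMap.adjoint T = T := by
    rw [LinearMap.isSymmetric_iff_isSelfAdjoint] at hT
    exact hT
  have heig := eigenvalues_eq_of_apply_basis T.isSymmetric_adjoint_comp_self hn
    ((hT.eigenvectorBasis hn).toBasis.reindex σ.symm) hanti (by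
      intro i
      simp only [Module.Basis.reindex_apply, Equiv.symm_symm, OrthonormalBasis.coe_toBasis,
        LinearMap.comp_apply, hadj]
      rw [hT.apply_eigenvectorBasis, map_smul, hT.apply_eigenvectorBasis, smul_smul, sq_abs, ← hα]
      push_cast
      rw [sq]
      rfl)
  refine ⟨σ, fun j => ?_⟩
  rw [T.singularValues_fin hn, heig, Real.sqrt_sq (abs_nonneg _)]

/-- **Weyl's monotonicity principle** for the ordered eigenvalues of symmetric operators. -/
theorem eigenvalues_le_of_le {S T : E →ₗ[ℂ] E} (hS : S.IsSymmetric) (hT : T.IsSymmetric)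
    (hn : Module.finrank ℂ E = n)
    (hle : ∀ x, (inner ℂ x (S x) : ℂ).re ≤ (inner ℂ x (T x) : ℂ).re) (i : Fin n) :
    hS.eigenvalues hn i ≤ hT.eigenvalues hn i := by
  have quad : ∀ {R : E →ₗ[ℂ] E} (hR : R.IsSymmetric) (x : E), (inner ℂ x (R x) : ℂ).re =
      ∑ j, hR.eigenvalues hn j * ‖(hR.eigenvectorBasis hn).repr x j‖ ^ 2 := by
    intro R hR x
    rw [← (hR.eigenvectorBasis hn).repr.inner_map_map, PiLp.inner_apply, Complex.re_sum]
    refine Finset.sum_congr rfl fun j _ => ?_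
    rw [hR.eigenvectorBasis_apply_self_apply, ← Complex.normSq_eq_norm_sq, Complex.normSq_apply]
    simp
    ring
  have norm : ∀ {R : E →ₗ[ℂ] E} (hR : R.IsSymmetric) (x : E), ‖x‖ ^ 2 =
      ∑ j, ‖(hR.eigenvectorBasis hn).repr x j‖ ^ 2 := by
    intro R hR x
    rw [← (hR.eigenvectorBasis hn).repr.norm_map, EuclideanSpace.norm_sq_eq]
  have repr_span : ∀ (b : OrthonormalBasis (Fin n) ℂ E) (p : Set (Fin n)) (x : E),
      x ∈ Submodule.span ℂ (b '' p) → ∀ j ∉ p, b.repr x j = 0 := by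
    intro b p x hx j hj
    induction hx using Submodule.span_induction with
    | mem x hx =>
      obtain ⟨l, hl, rfl⟩ := hx
      rw [b.repr_self]
      exact (PiLp.single_apply ..).trans (if_neg (by rintro rfl; exact hj hl))
    | zero => simp
    | add x y _ _ hx hy => rw [map_add, PiLp.add_apply, hx, hy, add_zero]
    | smul c x _ hx => rw [map_smul, PiLp.smul_apply, hx, smul_zero]
  have dim : ∀ (b : OrthonormalBasis (Fin n) ℂ E) (p : Finset (Fin n)),
      Module.finrank ℂ (Submodule.span ℂ (b '' p)) = p.card := by
    intro b p
    have hli : LinearIndependent ℂ (fun j : p => b j) :=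
      b.orthonormal.linearIndependent.comp _ Subtype.val_injective
    have := finrank_span_eq_card hli
    rw [Fintype.card_coe] at this
    rw [← this, Set.image_eq_range]
    rfl
  -- Courant–Fischer by dimension count: the leading `i + 1` eigenvectors of `S` and the trailing `n
  -- - i` of `T` span spaces that share a nonzero vector, on which the two forms are compared.
  set V := Submodule.span ℂ (hS.eigenvectorBasis hn '' (Finset.Iic i : Finset (Fin n)))
  set W := Submodule.span ℂ (hT.eigenvectorBasis hn '' (Finset.Ici i : Finset (Fin n)))
  have hV : Module.finrank ℂ V = i + 1 := by rw [dim, Fin.card_Iic]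
  have hW : Module.finrank ℂ W = n - i := by rw [dim, Fin.card_Ici]
  have hinf : (V ⊓ W) ≠ ⊥ := by
    intro h
    have h1 := Submodule.finrank_sup_add_finrank_inf_eq V W
    have h2 := Submodule.finrank_le (V ⊔ W)
    rw [h, finrank_bot] at h1
    have := i.isLt
    omega
  obtain ⟨x, hx, hx0⟩ := Submodule.exists_mem_ne_zero_of_ne_bot hinf
  have hpos : 0 < ‖x‖ ^ 2 := by positivity
  have h1 : hS.eigenvalues hn i * ‖x‖ ^ 2 ≤ (inner ℂ x (S x) : ℂ).re := by
    rw [quad hS, norm hS, Finset.mul_sum]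
    refine Finset.sum_le_sum fun j _ => ?_
    by_cases hj : j ≤ i
    · exact mul_le_mul_of_nonneg_right (hS.eigenvalues_antitone hn hj) (by positivity)
    · rw [repr_span _ _ x hx.1 j (by simpa using hj)]
      simp
  have h2 : (inner ℂ x (T x) : ℂ).re ≤ hT.eigenvalues hn i * ‖x‖ ^ 2 := by
    rw [quad hT, norm hT, Finset.mul_sum]
    refine Finset.sum_le_sum fun j _ => ?_
    by_cases hj : i ≤ j
    · exact mul_le_mul_of_nonneg_right (hT.eigenvalues_antitone hn hj) (by positivity)
    · rw [repr_span _ _ x hx.2 j (by simpa using hj)]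
      simp
  exact le_of_mul_le_mul_right (h1.trans ((hle x).trans h2)) hpos

theorem sum_eigenvalues_eq_re_trace {T : E →ₗ[ℂ] E} (hT : T.IsSymmetric)
    (hn : Module.finrank ℂ E = n) : ∑ i, hT.eigenvalues hn i = (LinearMap.trace ℂ E T).re := by
  exact (hT.re_trace_eq_sum_eigenvalues hn).symm

theorem sum_le_sum_range_of_antitone {g : ℕ → ℝ} (hg : Antitone g) (s : Finset ℕ) :
    ∑ j ∈ s, g j ≤ ∑ j ∈ Finset.range s.card, g j := by
  have hs : ∑ j ∈ s, g j = ∑ i : Fin s.card, g (s.orderEmbOfFin rfl i) := by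
    rw [← Finset.sum_coe_sort s g]
    exact ((s.orderIsoOfFin rfl).toEquiv.sum_comp (fun j : s => g j)).symm
  have hle : ∀ i : Fin s.card, (i : ℕ) ≤ s.orderEmbOfFin rfl i := by
    rintro ⟨i, hi⟩
    induction i with
    | zero => exact Nat.zero_le _
    | succ i ih =>
      refine Nat.succ_le_of_lt ((ih (Nat.lt_of_succ_lt hi)).trans_lt ?_)
      exact (s.orderEmbOfFin rfl).strictMono (by simp [Fin.lt_def])
  rw [hs, ← Fin.sum_univ_eq_sum_range]
  exact Finset.sum_le_sum fun i _ => hg (hle i)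

end Eigenvalues

/-! ### Heads and tails of the nuclear norm in terms of eigenvalues. -/

section NuclearNorm

variable {n : ℕ}

/-- The eigenvalues of a Hermitian matrix in non-increasing order, indexed by `Fin n`. -/
noncomputable def sortedEigenvalues {A : Matrix (Fin n) (Fin n) ℂ} (hA : A.IsHermitian) :
    Fin n → ℝ :=
  (Matrix.isSymmetric_toEuclideanLin_iff.mpr hA).eigenvalues (finrank_euclideanSpace_fin (n := n))

theorem singularValue_antitone (A : Matrix (Fin n) (Fin n) ℂ) : Antitone (singularValue A) :=
  (Matrix.toEuclideanLin A).singularValues_antitone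

theorem singularValue_nonneg (A : Matrix (Fin n) (Fin n) ℂ) (j : ℕ) : 0 ≤ singularValue A j :=
  (Matrix.toEuclideanLin A).singularValues_nonneg j

theorem nuclearTail_nonneg (r : ℕ) (A : Matrix (Fin n) (Fin n) ℂ) : 0 ≤ nuclearTail r A :=
  Finset.sum_nonneg fun _ _ => singularValue_nonneg A _

theorem exists_perm_abs_sortedEigenvalues {A : Matrix (Fin n) (Fin n) ℂ} (hA : A.IsHermitian) :
    ∃ σ : Equiv.Perm (Fin n), ∀ j, |sortedEigenvalues hA (σ j)| = singularValue A j :=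
  exists_perm_abs_eigenvalues_eq_singularValues _ _

theorem sum_sortedEigenvalues {A : Matrix (Fin n) (Fin n) ℂ} (hA : A.IsHermitian) :
    ∑ i, sortedEigenvalues hA i = A.trace.re := by
  rw [sortedEigenvalues, sum_eigenvalues_eq_re_trace, Matrix.toEuclideanLin, Matrix.toLpLin_eq_toLin,
    Matrix.trace_toLin_eq]

/-- The sum of the `r` largest singular values. -/
noncomputable def nuclearHead (r : ℕ) (A : Matrix (Fin n) (Fin n) ℂ) : ℝ :=
  ∑ j ∈ Finset.range r, singularValue A j

theorem nuclearHead_add_nuclearTail {r : ℕ} (hr : r ≤ n) (A : Matrix (Fin n) (Fin n) ℂ) :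
    nuclearHead r A + nuclearTail r A = nuclearNorm A :=
  Finset.sum_range_add_sum_Ico _ hr

theorem nuclearNorm_eq_sum_abs {A : Matrix (Fin n) (Fin n) ℂ} (hA : A.IsHermitian) :
    nuclearNorm A = ∑ i, |sortedEigenvalues hA i| := by
  obtain ⟨σ, hσ⟩ := exists_perm_abs_sortedEigenvalues hA
  rw [nuclearNorm, ← Fin.sum_univ_eq_sum_range,
    ← Equiv.sum_comp σ (fun i => |sortedEigenvalues hA i|)]
  exact Finset.sum_congr rfl fun j _ => (hσ j).symm

theorem sum_abs_le_nuclearHead {A : Matrix (Fin n) (Fin n) ℂ} (hA : A.IsHermitian)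
    (s : Finset (Fin n)) : ∑ i ∈ s, |sortedEigenvalues hA i| ≤ nuclearHead s.card A := by
  obtain ⟨σ, hσ⟩ := exists_perm_abs_sortedEigenvalues hA
  have h := sum_le_sum_range_of_antitone (singularValue_antitone A)
    ((s.map σ.symm.toEmbedding).map Fin.valEmbedding)
  rw [Finset.card_map, Finset.card_map, Finset.sum_map, Finset.sum_map] at h
  refine le_trans (Finset.sum_le_sum fun i _ => ?_) h
  have := hσ (σ.symm i)
  rw [Equiv.apply_symm_apply] at this
  exact this.le

theorem exists_sum_abs_eq_nuclearHead {A : Matrix (Fin n) (Fin n) ℂ} (hA : A.IsHermitian)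
    {r : ℕ} (hr : r ≤ n) :
    ∃ s : Finset (Fin n), s.card = r ∧ ∑ i ∈ s, |sortedEigenvalues hA i| = nuclearHead r A := by
  obtain ⟨σ, hσ⟩ := exists_perm_abs_sortedEigenvalues hA
  refine ⟨(Finset.univ : Finset (Fin r)).map ((Fin.castLEEmb hr).trans σ.toEmbedding), by simp, ?_⟩
  rw [Finset.sum_map, nuclearHead, ← Fin.sum_univ_eq_sum_range]
  exact Finset.sum_congr rfl fun j _ => hσ (Fin.castLE hr j)

/-- Tail minus head is the minimum, over index sets `s` of size `r`, of the sum of `|eigenvalue|`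
off `s` minus the sum on `s`. It suffices to test `A` with a set optimal for `B`. -/
theorem nuclearTail_sub_nuclearHead_le {A B : Matrix (Fin n) (Fin n) ℂ} (hA : A.IsHermitian)
    (hB : B.IsHermitian) {r : ℕ} (hr : r ≤ n) :
    nuclearTail r A - nuclearHead r A ≤ nuclearTail r B - nuclearHead r B +
      ∑ i, |sortedEigenvalues hA i - sortedEigenvalues hB i| := by
  obtain ⟨s, hs, hsum⟩ := exists_sum_abs_eq_nuclearHead hB hr
  have h1 := sum_abs_le_nuclearHead hA s
  rw [hs] at h1
  have h2 := nuclearHead_add_nuclearTail hr A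
  have h3 := nuclearHead_add_nuclearTail hr B
  rw [nuclearNorm_eq_sum_abs hA, ← Finset.sum_add_sum_compl s] at h2
  rw [nuclearNorm_eq_sum_abs hB, ← Finset.sum_add_sum_compl s] at h3
  rw [← Finset.sum_add_sum_compl s]
  have h4 : ∑ i ∈ sᶜ, |sortedEigenvalues hA i| ≤ ∑ i ∈ sᶜ, |sortedEigenvalues hB i| +
      ∑ i ∈ sᶜ, |sortedEigenvalues hA i - sortedEigenvalues hB i| := by
    rw [← Finset.sum_add_distrib]
    refine Finset.sum_le_sum fun i _ => ?_
    linarith [abs_sub_abs_le_abs_sub (sortedEigenvalues hA i) (sortedEigenvalues hB i)]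
  have h5 : ∑ i ∈ s, |sortedEigenvalues hB i| ≤ ∑ i ∈ s, |sortedEigenvalues hA i| +
      ∑ i ∈ s, |sortedEigenvalues hA i - sortedEigenvalues hB i| := by
    rw [← Finset.sum_add_distrib]
    refine Finset.sum_le_sum fun i _ => ?_
    rw [abs_sub_comm]
    linarith [abs_sub_abs_le_abs_sub (sortedEigenvalues hB i) (sortedEigenvalues hA i)]
  linarith

-- By Weyl monotonicity all the differences have one sign, so their absolute sum is a trace.
open scoped ComplexOrder in
theorem sum_abs_sub_sortedEigenvalues {A B : Matrix (Fin n) (Fin n) ℂ} (hA : A.IsHermitian)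
    (hB : B.IsHermitian) (h : (A - B).PosSemidef) :
    ∑ i, |sortedEigenvalues hA i - sortedEigenvalues hB i| = (A - B).trace.re := by
  have hle : ∀ i, sortedEigenvalues hB i ≤ sortedEigenvalues hA i := by
    refine eigenvalues_le_of_le _ _ _ fun x => ?_
    have h1 := (Matrix.isPositive_toEuclideanLin_iff.2 h).re_inner_nonneg_right x
    rw [map_sub, LinearMap.sub_apply, inner_sub_right, map_sub] at h1
    exact sub_nonneg.1 h1
  rw [Matrix.trace_sub, Complex.sub_re, ← sum_sortedEigenvalues hA, ← sum_sortedEigenvalues hB,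
    ← Finset.sum_sub_distrib]
  exact Finset.sum_congr rfl fun i _ => abs_of_nonneg (sub_nonneg.2 (hle i))

end NuclearNorm

/-! ### Spectral decomposition and the Lipschitz estimate for tail minus head. -/

section Spectral

variable {n : ℕ}

/-- The spectral decomposition of a Hermitian matrix, with the eigenvalues ordered by decreasing
absolute value. -/
theorem exists_spectral_decomposition {Z : Matrix (Fin n) (Fin n) ℂ} (hZ : Z.IsHermitian) :
    ∃ (U : Matrix (Fin n) (Fin n) ℂ) (d : Fin n → ℝ), Uᴴ * U = 1 ∧
      Z = U * Matrix.diagonal (fun i => (d i : ℂ)) * Uᴴ ∧ ∀ j, |d j| = singularValue Z j := by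
  obtain ⟨σ, hσ⟩ := exists_perm_abs_sortedEigenvalues hZ
  have hT := Matrix.isSymmetric_toEuclideanLin_iff.mpr hZ
  set b := hT.eigenvectorBasis (finrank_euclideanSpace_fin (n := n)) with hb
  set U : Matrix (Fin n) (Fin n) ℂ := Matrix.of fun i j => b (σ j) i with hU
  have hUU : Uᴴ * U = 1 := by
    ext i j
    have h1 := orthonormal_iff_ite.1 b.orthonormal (σ i) (σ j)
    rw [PiLp.inner_apply] at h1
    rw [Matrix.mul_apply, Matrix.one_apply]
    simp only [EmbeddingLike.apply_eq_iff_eq] at h1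
    rw [← h1]
    refine Finset.sum_congr rfl fun l _ => ?_
    simp [hU, mul_comm]
  refine ⟨U, fun j => sortedEigenvalues hZ (σ j), hUU, ?_, hσ⟩
  have hcol : Z * U = U * Matrix.diagonal (fun i => (sortedEigenvalues hZ (σ i) : ℂ)) := by
    ext i j
    rw [Matrix.mul_diagonal]
    have h1 := hT.apply_eigenvectorBasis (finrank_euclideanSpace_fin (n := n)) (σ j)
    have h2 := congrArg (fun v : EuclideanSpace ℂ (Fin n) => v i) h1
    simp only [Matrix.toEuclideanLin, Matrix.ofLp_toLpLin, Matrix.toLin'_apply, PiLp.smul_apply,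
      smul_eq_mul] at h2
    rw [mul_comm]
    exact h2
  rw [← hcol, Matrix.mul_assoc, mul_eq_one_comm.mp hUU, Matrix.mul_one]

theorem isHermitian_conj_diagonal {ι : Type*} [Fintype ι] [DecidableEq ι]
    (U : Matrix (Fin n) ι ℂ) (d : ι → ℝ) :
    (U * Matrix.diagonal (fun i => (d i : ℂ)) * Uᴴ).IsHermitian := by
  rw [Matrix.IsHermitian, Matrix.conjTranspose_mul, Matrix.conjTranspose_mul,
    Matrix.conjTranspose_conjTranspose, Matrix.diagonal_conjTranspose, Matrix.mul_assoc]
  congr 3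
  ext i
  simp

open scoped ComplexOrder in
/-- For Hermitian matrices, `A ↦ ‖A_c‖_* - ‖A_r‖_*` is Lipschitz for the nuclear norm. -/
theorem nuclearTail_sub_nuclearHead_sub_le {X Y : Matrix (Fin n) (Fin n) ℂ} (hX : X.IsHermitian)
    (hY : Y.IsHermitian) {r : ℕ} (hr : r ≤ n) :
    nuclearTail r (X - Y) - nuclearHead r (X - Y) ≤
      nuclearTail r X - nuclearHead r X + nuclearNorm Y := by
  obtain ⟨U, d, hU, hYd, hd⟩ := exists_spectral_decomposition hY
  have psd : ∀ e : Fin n → ℝ, (∀ i, 0 ≤ e i) →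
      (U * Matrix.diagonal (fun i => (e i : ℂ)) * Uᴴ).PosSemidef := by
    intro e he
    apply Matrix.PosSemidef.mul_mul_conjTranspose_same
    exact Matrix.PosSemidef.diagonal fun i => by
      change (0 : ℂ) ≤ (e i : ℂ)
      exact_mod_cast he i
  have tr : ∀ e : Fin n → ℝ,
      (U * Matrix.diagonal (fun i => (e i : ℂ)) * Uᴴ).trace.re = ∑ i, e i := by
    intro e
    rw [Matrix.trace_mul_comm, ← Matrix.mul_assoc, hU, Matrix.one_mul, Matrix.trace_diagonal,
      Complex.re_sum]
    simp
  set P := U * Matrix.diagonal (fun i => ((max (d i) 0 : ℝ) : ℂ)) * Uᴴ with hP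
  set N := U * Matrix.diagonal (fun i => ((max (-d i) 0 : ℝ) : ℂ)) * Uᴴ with hN
  have hPpsd : P.PosSemidef := psd _ fun i => le_max_right _ _
  have hNpsd : N.PosSemidef := psd _ fun i => le_max_right _ _
  have hYPN : Y = P - N := by
    rw [hYd, hP, hN, ← sub_mul, ← mul_sub, Matrix.diagonal_sub]
    congr 3
    ext i
    rw [← Complex.ofReal_sub]
    congr 1
    rcases le_total (d i) 0 with h | h
    · rw [max_eq_right h, max_eq_left (by linarith)]; ring
    · rw [max_eq_left h, max_eq_right (by linarith)]; ring
  -- `X + N` dominates both `X - Y` (by `P`) and `X` (by `N`). Passing through it needs only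
  -- monotone comparisons, at total cost `tr P + tr N = ‖Y‖_*`.
  have hXN : (X + N).IsHermitian := hX.add hNpsd.1
  have h1 : X + N - (X - Y) = P := by rw [hYPN]; abel
  have h2 : X + N - X = N := by abel
  have h3 := sum_abs_sub_sortedEigenvalues hXN (hX.sub hY) (by rw [h1]; exact hPpsd)
  have h4 := sum_abs_sub_sortedEigenvalues hXN hX (by rw [h2]; exact hNpsd)
  rw [h1, show P.trace.re = _ from tr _] at h3
  rw [h2, show N.trace.re = _ from tr _] at h4
  have h5 := nuclearTail_sub_nuclearHead_le (hX.sub hY) hXN hr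
  have h6 := nuclearTail_sub_nuclearHead_le hXN hX hr
  simp_rw [abs_sub_comm (sortedEigenvalues (hX.sub hY) _)] at h5
  have h7 : nuclearNorm Y = ∑ i, max (d i) 0 + ∑ i, max (-d i) 0 := by
    rw [nuclearNorm, ← Fin.sum_univ_eq_sum_range, ← Finset.sum_add_distrib]
    refine Finset.sum_congr rfl fun i _ => ?_
    rw [← hd]
    rcases abs_cases (d i) with ⟨h, h'⟩ | ⟨h, h'⟩ <;> rw [h]
    · rw [max_eq_left h', max_eq_right (by linarith), add_zero]
    · rw [max_eq_right h'.le, max_eq_left (by linarith), zero_add]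
  linarith

end Spectral

/-! ### The Frobenius norm and its invariance under isometries. -/

section Frobenius

open scoped Matrix.Norms.Frobenius

theorem frobenius_norm_sq_eq_trace {m n : Type*} [Fintype m] [Fintype n] (A : Matrix m n ℂ) :
    ‖A‖ ^ 2 = (Aᴴ * A).trace.re := by
  have h : ‖A‖ ^ 2 = ∑ i, ∑ j, ‖A i j‖ ^ 2 := by
    rw [Matrix.frobenius_norm_def, ← Real.sqrt_eq_rpow, Real.sq_sqrt (by positivity)]
    simp
  rw [h, Matrix.trace, Complex.re_sum, Finset.sum_comm]
  refine Finset.sum_congr rfl fun j _ => ?_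
  rw [Matrix.diag_apply, Matrix.mul_apply, Complex.re_sum]
  refine Finset.sum_congr rfl fun i _ => ?_
  rw [← Complex.normSq_eq_norm_sq, Complex.normSq_apply]
  simp

theorem frobeniusNorm_eq_norm {n : ℕ} (A : Matrix (Fin n) (Fin n) ℂ) : frobeniusNorm A = ‖A‖ := by
  rw [frobeniusNorm, ← frobenius_norm_sq_eq_trace, Real.sqrt_sq (norm_nonneg _)]

variable {l m n : Type*} [Fintype l] [Fintype m] [Fintype n] [DecidableEq l]

theorem norm_isometry_mul {U : Matrix n l ℂ} (hU : Uᴴ * U = 1) (A : Matrix l m ℂ) :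
    ‖U * A‖ = ‖A‖ := by
  rw [← sq_eq_sq₀ (norm_nonneg _) (norm_nonneg _), frobenius_norm_sq_eq_trace,
    frobenius_norm_sq_eq_trace, Matrix.conjTranspose_mul, Matrix.mul_assoc, ← Matrix.mul_assoc Uᴴ,
    hU, Matrix.one_mul]

theorem norm_mul_isometry_conjTranspose {U : Matrix n l ℂ} (hU : Uᴴ * U = 1) (A : Matrix m l ℂ) :
    ‖A * Uᴴ‖ = ‖A‖ := by
  rw [← Matrix.frobenius_norm_conjTranspose, Matrix.conjTranspose_mul,
    Matrix.conjTranspose_conjTranspose, norm_isometry_mul hU, Matrix.frobenius_norm_conjTranspose]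

theorem norm_sq_diagonal (d : l → ℝ) :
    ‖Matrix.diagonal (fun i => (d i : ℂ))‖ ^ 2 = ∑ i, d i ^ 2 := by
  rw [Matrix.frobenius_norm_diagonal, EuclideanSpace.norm_sq_eq]
  simp

theorem norm_sq_conj_diagonal {U : Matrix n l ℂ} (hU : Uᴴ * U = 1) (d : l → ℝ) :
    ‖U * Matrix.diagonal (fun i => (d i : ℂ)) * Uᴴ‖ ^ 2 = ∑ i, d i ^ 2 := by
  rw [norm_mul_isometry_conjTranspose hU, norm_isometry_mul hU, norm_sq_diagonal]

end Frobenius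

/-! ### Nets and colourings in finite-dimensional normed spaces. -/

section Nets

/-- A 1-separated subset of the ball of radius 2 has at most `5 ^ dim` points, and one of maximal
cardinality must be a 1-net. -/
theorem exists_maximal_separated (E : Type*) [NormedAddCommGroup E] [NormedSpace ℝ E]
    [FiniteDimensional ℝ E] :
    ∃ s : Finset E, s.card ≤ 5 ^ Module.finrank ℝ E ∧
      ∀ x : E, ‖x‖ ≤ 2 → ∃ c ∈ s, ‖x - c‖ ≤ 1 := by
  classical
  set S : Set ℕ := {k | ∃ s : Finset E, (∀ c ∈ s, ‖c‖ ≤ 2) ∧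
    (∀ c ∈ s, ∀ d ∈ s, c ≠ d → 1 ≤ ‖c - d‖) ∧ s.card = k}
  have hbdd : BddAbove S := by
    refine ⟨5 ^ Module.finrank ℝ E, ?_⟩
    rintro _ ⟨s, h1, h2, rfl⟩
    exact Besicovitch.card_le_of_separated s h1 h2
  have hne : S.Nonempty := ⟨0, ∅, by simp⟩
  obtain ⟨s, h1, h2, h3⟩ := Nat.sSup_mem hne hbdd
  refine ⟨s, Besicovitch.card_le_of_separated s h1 h2, fun x hx => ?_⟩
  by_contra! hcon
  have hxs : x ∉ s := fun h => by
    have := hcon x h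
    simp at this
    linarith
  have hmem : (insert x s).card ∈ S := by
    refine ⟨insert x s, ?_, ?_, rfl⟩
    · simpa [hx] using h1
    · intro c hc d hd hcd
      rcases Finset.mem_insert.1 hc with rfl | hc' <;> rcases Finset.mem_insert.1 hd with rfl | hd'
      · exact absurd rfl hcd
      · exact (hcon d hd').le
      · rw [norm_sub_rev]
        exact (hcon c hc').le
      · exact h2 c hc' d hd' hcd
  have := le_csSup hbdd hmem
  rw [Finset.card_insert_of_notMem hxs, h3] at this
  omega

/-- A colouring of a finite-dimensional normed space with few colours, such that two points of the
ball of radius two with the same colour are close. -/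
theorem exists_colouring (E : Type*) [NormedAddCommGroup E] [NormedSpace ℝ E]
    [FiniteDimensional ℝ E] (t : ℕ) :
    ∃ c : E → Fin ((5 ^ t) ^ Module.finrank ℝ E), ∀ x y : E, ‖x‖ ≤ 2 → ‖y‖ ≤ 2 → c x = c y →
      ‖x - y‖ ≤ 4 / 2 ^ t := by
  obtain ⟨s, hs, hcov⟩ := exists_maximal_separated E
  choose! q hq hq1 using hcov
  induction t with
  | zero =>
    refine ⟨fun _ => ⟨0, by positivity⟩, fun x y hx hy _ => ?_⟩
    have := norm_sub_le x y
    norm_num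
    linarith
  | succ t ih =>
    obtain ⟨c, hc⟩ := ih
    obtain ⟨e⟩ : Nonempty (s ↪ Fin (5 ^ Module.finrank ℝ E)) :=
      Function.Embedding.nonempty_of_card_le (by simpa using hs)
    classical
    have hcard : 5 ^ Module.finrank ℝ E * (5 ^ t) ^ Module.finrank ℝ E =
        (5 ^ (t + 1)) ^ Module.finrank ℝ E := by
      rw [← mul_pow, pow_succ']
    -- The new colour records the net point `q x` together with the old colour of the residual `x -
    -- q x`, rescaled to the ball of radius 2. Each round costs a factor `5 ^ dim` and halves the
    -- distance.
    refine ⟨fun x => Fin.cast hcard (finProdFinEquiv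
      (if h : q x ∈ s then e ⟨q x, h⟩ else ⟨0, by positivity⟩, c ((2 : ℝ) • (x - q x)))),
      fun x y hx hy hxy => ?_⟩
    have h1 := finProdFinEquiv.injective (Fin.cast_injective hcard hxy)
    rw [Prod.mk.injEq, dif_pos (hq x hx), dif_pos (hq y hy)] at h1
    have h2 : q x = q y := congrArg Subtype.val (e.injective h1.1)
    have h3 : ∀ z : E, ‖z‖ ≤ 2 → ‖(2 : ℝ) • (z - q z)‖ ≤ 2 := fun z hz => by
      rw [norm_smul, Real.norm_of_nonneg (by norm_num)]
      linarith [hq1 z hz]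
    have h4 := hc _ _ (h3 x hx) (h3 y hy) h1.2
    rw [← smul_sub, h2, sub_sub_sub_cancel_right, norm_smul,
      Real.norm_of_nonneg (by norm_num)] at h4
    rw [pow_succ, ← div_div]
    linarith

/-- One representative per colour gives a net lying inside `S`, even for a nonlinear `S` such as the
matrices of bounded rank. -/
theorem exists_finset_of_colouring {α ι : Type*} [Fintype ι] (S : Set α) (c : α → ι) :
    ∃ F : Finset α, (∀ w ∈ F, w ∈ S) ∧ F.card ≤ Fintype.card ι ∧
      ∀ z ∈ S, ∃ w ∈ F, c z = c w := by
  classical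
  obtain ⟨T, hT, hbij⟩ := (Set.surjOn_image c S).exists_bijOn_subset
  have hfin : T.Finite := Set.Finite.of_finite_image (Set.toFinite (c '' T)) hbij.injOn
  refine ⟨hfin.toFinset, fun w hw => hT (hfin.mem_toFinset.1 hw), ?_, fun z hz => ?_⟩
  · rw [← Finset.card_image_of_injOn (f := c) (by simpa using hbij.injOn)]
    exact Finset.card_le_univ _
  · obtain ⟨w, hw, hcw⟩ := hbij.surjOn (Set.mem_image_of_mem c hz)
    exact ⟨w, hfin.mem_toFinset.2 hw, hcw.symm⟩

end Nets

/-! ### Nets of normalized low-rank Hermitian matrices. -/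

section SpectralForm

open scoped Matrix.Norms.Frobenius

variable {n R : ℕ}

/-- `Z` is a real linear combination of the projections onto the members of an orthonormal
family of length `R`. -/
def HasSpectralForm (R : ℕ) (Z : Matrix (Fin n) (Fin n) ℂ) : Prop :=
  ∃ (U : Matrix (Fin n) (Fin R) ℂ) (d : Fin R → ℝ), Uᴴ * U = 1 ∧
    Z = U * Matrix.diagonal (fun i => (d i : ℂ)) * Uᴴ

theorem HasSpectralForm.isHermitian {Z : Matrix (Fin n) (Fin n) ℂ} (h : HasSpectralForm R Z) :
    Z.IsHermitian := by
  obtain ⟨U, d, -, rfl⟩ := h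
  exact isHermitian_conj_diagonal U d

theorem HasSpectralForm.smul {Z : Matrix (Fin n) (Fin n) ℂ} (h : HasSpectralForm R Z) (c : ℝ) :
    HasSpectralForm R (c • Z) := by
  obtain ⟨U, d, hU, rfl⟩ := h
  refine ⟨U, fun i => c * d i, hU, ?_⟩
  rw [← Matrix.smul_mul, ← Matrix.mul_smul, ← Matrix.diagonal_smul]
  congr 3
  ext i
  simp

theorem HasSpectralForm.rank_le {Z : Matrix (Fin n) (Fin n) ℂ} (h : HasSpectralForm R Z) :
    Z.rank ≤ R := by
  obtain ⟨U, d, -, rfl⟩ := h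
  rw [Matrix.mul_assoc]
  exact (Matrix.rank_mul_le_left _ _).trans ((Matrix.rank_le_card_width U).trans (by simp))

theorem hasSpectralForm_of_support {U : Matrix (Fin n) (Fin n) ℂ} (hU : Uᴴ * U = 1) {d : Fin n → ℝ}
    {s : Finset (Fin n)} (hs : s.card ≤ R) (hR : R ≤ n) (hd : ∀ i ∉ s, d i = 0) :
    HasSpectralForm R (U * Matrix.diagonal (fun i => (d i : ℂ)) * Uᴴ) := by
  -- The form asks for exactly `R` columns, so the support is padded with indices whose coefficient
  -- is zero.
  obtain ⟨t, hst, ht⟩ := Finset.exists_superset_card_eq hs (by simpa using hR)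
  set e := t.orderIsoOfFin ht
  refine ⟨U.submatrix id (fun i => e i), fun i => d (e i), ?_, ?_⟩
  · have : (U.submatrix id (fun i => (e i : Fin n)))ᴴ * U.submatrix id (fun i => (e i : Fin n)) =
        (Uᴴ * U).submatrix (fun i => (e i : Fin n)) (fun i => (e i : Fin n)) := by
      rw [Matrix.conjTranspose_submatrix, ← Matrix.submatrix_mul _ _ _ id _ Function.bijective_id]
    rw [this, hU]
    exact Matrix.submatrix_one _ (Subtype.val_injective.comp e.injective)
  · ext a b
    rw [Matrix.mul_apply, Matrix.mul_apply]
    simp only [Matrix.mul_diagonal, Matrix.conjTranspose_apply, Matrix.submatrix_apply, id]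
    rw [← Finset.sum_subset (Finset.subset_univ t) fun i _ hi => by
      rw [hd i fun h => hi (hst h)]; simp, ← Finset.sum_coe_sort t]
    exact (e.toEquiv.sum_comp (fun i : t => U a i * (d i : ℂ) * star (U b i))).symm

theorem rank_add_le (A B : Matrix (Fin n) (Fin n) ℂ) : (A + B).rank ≤ A.rank + B.rank := by
  have h : (A + B).mulVecLin.range ≤ A.mulVecLin.range ⊔ B.mulVecLin.range := by
    rintro _ ⟨x, rfl⟩
    rw [Matrix.mulVecLin_add]
    exact Submodule.add_mem_sup ⟨x, rfl⟩ ⟨x, rfl⟩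
  exact (Submodule.finrank_mono h).trans (Submodule.finrank_add_le_finrank_add_finrank _ _)

theorem singularValue_eq_zero_of_rank_le {X : Matrix (Fin n) (Fin n) ℂ} {j : ℕ} (h : X.rank ≤ j) :
    singularValue X j = 0 := by
  rw [singularValue, LinearMap.singularValues_eq_zero_iff_le_finrank_range]
  rwa [Matrix.rank_eq_finrank_range_toLin X (PiLp.basisFun 2 ℂ (Fin n))
    (PiLp.basisFun 2 ℂ (Fin n)), ← Matrix.toLpLin_eq_toLin] at h

/-- The difference between a matrix and its net point has rank up to `2 * R`; splitting it lets
bounds for length `R` apply to it. -/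
theorem exists_add_of_rank_le {D : Matrix (Fin n) (Fin n) ℂ} (hD : D.IsHermitian)
    (hrank : D.rank ≤ 2 * R) (hR : R ≤ n) :
    ∃ D₁ D₂, HasSpectralForm R D₁ ∧ HasSpectralForm R D₂ ∧ D = D₁ + D₂ ∧ ‖D₁‖ ≤ ‖D‖ ∧
      ‖D₂‖ ≤ ‖D‖ := by
  obtain ⟨U, d, hU, hDU, hd⟩ := exists_spectral_decomposition hD
  have hle : ∀ p : Fin n → Prop, [DecidablePred p] →
      ‖U * Matrix.diagonal (fun i => ((if p i then d i else 0 : ℝ) : ℂ)) * Uᴴ‖ ≤ ‖D‖ := by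
    intro p _
    rw [← sq_le_sq₀ (norm_nonneg _) (norm_nonneg _), hDU, norm_sq_conj_diagonal hU,
      norm_sq_conj_diagonal hU]
    refine Finset.sum_le_sum fun i _ => ?_
    split_ifs
    · exact le_rfl
    · rw [zero_pow two_ne_zero]
      positivity
  refine ⟨U * Matrix.diagonal (fun i => ((if i.val < R then d i else 0 : ℝ) : ℂ)) * Uᴴ,
    U * Matrix.diagonal (fun i => ((if ¬ i.val < R then d i else 0 : ℝ) : ℂ)) * Uᴴ, ?_, ?_, ?_,
    hle _, hle _⟩
  · refine hasSpectralForm_of_support hU (s := Finset.univ.filter fun i => i.val < R) ?_ hR ?_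
    · rw [← Finset.card_map Fin.valEmbedding]
      refine (Finset.card_le_card (t := Finset.range R) ?_).trans (by simp)
      intro j hj
      simp only [Finset.mem_map, Finset.mem_filter, Finset.mem_univ, true_and] at hj
      obtain ⟨i, hi, rfl⟩ := hj
      simpa using hi
    · intro i hi
      simp at hi
      simp [hi]
  · refine hasSpectralForm_of_support hU
      (s := Finset.univ.filter fun i => R ≤ i.val ∧ i.val < 2 * R) ?_ hR ?_
    · rw [← Finset.card_map Fin.valEmbedding]
      refine (Finset.card_le_card (t := Finset.Ico R (2 * R)) ?_).trans (by simp; omega)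
      intro j hj
      simp only [Finset.mem_map, Finset.mem_filter, Finset.mem_univ, true_and] at hj
      obtain ⟨i, hi, rfl⟩ := hj
      simpa using hi
    · intro i hi
      simp only [Finset.mem_filter, Finset.mem_univ, true_and, not_and, not_lt] at hi
      split_ifs with h
      · rfl
      · have := hd i
        rw [singularValue_eq_zero_of_rank_le (hrank.trans (hi (not_lt.1 h)))] at this
        exact abs_eq_zero.1 this
  · conv_lhs => rw [hDU]
    rw [← add_mul, ← mul_add, Matrix.diagonal_add]
    congr 3
    ext i
    by_cases h : i.val < R <;> simp [h]

/-- Closeness of each column suffices, because `‖(U - V) Λ‖²` averages the squared column errors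
with weights `d j²` of sum 1. -/
theorem norm_conj_diagonal_sub_le {U V : Matrix (Fin n) (Fin R) ℂ} (hU : Uᴴ * U = 1)
    (hV : Vᴴ * V = 1) {d e : Fin R → ℝ} (hd : ∑ i, d i ^ 2 = 1) {ε : ℝ} (hε : 0 ≤ ε)
    (hcol : ∀ j, ‖(WithLp.toLp 2 (fun i => U i j - V i j) : EuclideanSpace ℂ (Fin n))‖ ≤ ε)
    (hde : ∑ i, (d i - e i) ^ 2 ≤ ε ^ 2) :
    ‖U * Matrix.diagonal (fun i => (d i : ℂ)) * Uᴴ -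
      V * Matrix.diagonal (fun i => (e i : ℂ)) * Vᴴ‖ ≤ 3 * ε := by
  set Λ := Matrix.diagonal (fun i => (d i : ℂ)) with hΛ
  set Γ := Matrix.diagonal (fun i => (e i : ℂ)) with hΓ
  have hsplit : U * Λ * Uᴴ - V * Γ * Vᴴ =
      (U - V) * Λ * Uᴴ + V * (Λ * (U - V)ᴴ) + V * (Λ - Γ) * Vᴴ := by
    rw [Matrix.conjTranspose_sub]
    simp only [Matrix.sub_mul, Matrix.mul_sub, Matrix.mul_assoc]
    abel
  have h1 : ‖(U - V) * Λ‖ ≤ ε := by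
    rw [← sq_le_sq₀ (norm_nonneg _) hε, frobenius_norm_sq_eq_trace, Matrix.trace, Complex.re_sum]
    calc ∑ j, ((((U - V) * Λ)ᴴ * ((U - V) * Λ)).diag j).re
        = ∑ j, d j ^ 2 *
          ‖(WithLp.toLp 2 (fun i => U i j - V i j) : EuclideanSpace ℂ (Fin n))‖ ^ 2 := by
          refine Finset.sum_congr rfl fun j _ => ?_
          rw [EuclideanSpace.norm_sq_eq, Matrix.diag_apply, Matrix.mul_apply, Complex.re_sum,
            Finset.mul_sum]
          refine Finset.sum_congr rfl fun i _ => ?_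
          rw [Matrix.conjTranspose_apply, hΛ, Matrix.mul_diagonal, Matrix.sub_apply,
            ← Complex.normSq_eq_norm_sq, Complex.normSq_apply]
          simp
          ring
      _ ≤ ∑ j, d j ^ 2 * ε ^ 2 := by
          refine Finset.sum_le_sum fun j _ => ?_
          gcongr
          exact hcol j
      _ = ε ^ 2 := by rw [← Finset.sum_mul, hd, one_mul]
  have h2 : ‖Λ * (U - V)ᴴ‖ ≤ ε := by
    rw [← Matrix.frobenius_norm_conjTranspose, Matrix.conjTranspose_mul,
      Matrix.conjTranspose_conjTranspose]
    have : Λᴴ = Λ := by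
      rw [hΛ, Matrix.diagonal_conjTranspose]
      congr 1
      ext i
      simp
    rw [this]
    exact h1
  have h3 : ‖Λ - Γ‖ ≤ ε := by
    have : Λ - Γ = Matrix.diagonal (fun i => ((d i - e i : ℝ) : ℂ)) := by
      rw [hΛ, hΓ, Matrix.diagonal_sub]
      congr 1
      ext i
      simp
    rw [← sq_le_sq₀ (norm_nonneg _) hε, this, norm_sq_diagonal]
    exact hde
  rw [hsplit]
  refine (norm_add₃_le).trans ?_
  rw [norm_mul_isometry_conjTranspose hU, norm_isometry_mul hV,
    norm_mul_isometry_conjTranspose hV, norm_isometry_mul hV]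
  linarith

/-- A finite net of the normalized matrices with a spectral form of length `R`. -/
theorem exists_net (hn : 1 ≤ n) (R t : ℕ) :
    ∃ F : Finset (Matrix (Fin n) (Fin n) ℂ), F.card ≤ (5 ^ t) ^ (3 * n * R) ∧
      (∀ W ∈ F, HasSpectralForm R W ∧ ‖W‖ = 1) ∧
      ∀ Z, HasSpectralForm R Z → ‖Z‖ = 1 →
        ∃ W ∈ F, ‖Z - W‖ ≤ 3 * (4 / 2 ^ t) ∧ (Z - W).rank ≤ 2 * R := by
  obtain ⟨c₁, hc₁⟩ := exists_colouring (EuclideanSpace ℂ (Fin n)) t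
  obtain ⟨c₂, hc₂⟩ := exists_colouring (EuclideanSpace ℝ (Fin R)) t
  have hch : ∀ Z : Matrix (Fin n) (Fin n) ℂ, HasSpectralForm R Z →
      ∃ (U : Matrix (Fin n) (Fin R) ℂ) (d : Fin R → ℝ), Uᴴ * U = 1 ∧
        Z = U * Matrix.diagonal (fun i => (d i : ℂ)) * Uᴴ := fun Z h => h
  choose! U d hU hZ using hch
  obtain ⟨F, hFS, hFcard, hF⟩ := exists_finset_of_colouring
    {Z : Matrix (Fin n) (Fin n) ℂ | HasSpectralForm R Z ∧ ‖Z‖ = 1}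
    (fun Z => ((fun j => c₁ (WithLp.toLp 2 fun i => U Z i j), c₂ (WithLp.toLp 2 (d Z))) :
      (Fin R → Fin _) × Fin _))
  refine ⟨F, hFcard.trans ?_, hFS, fun Z hZs hZ1 => ?_⟩
  · rw [Fintype.card_prod, Fintype.card_fun, Fintype.card_fin, Fintype.card_fin, Fintype.card_fin,
      finrank_real_of_complex, finrank_euclideanSpace_fin, finrank_euclideanSpace_fin, ← pow_mul,
      ← pow_add]
    refine Nat.pow_le_pow_right (by positivity) ?_
    -- There are `R` columns of real dimension `2 n` and a coefficient vector of dimension `R`; `2 n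
    -- R + R ≤ 3 n R` because `1 ≤ n`.
    nlinarith [Nat.mul_le_mul_right R hn]
  · obtain ⟨W, hWF, hcW⟩ := hF Z ⟨hZs, hZ1⟩
    obtain ⟨hWs, hW1⟩ := hFS W hWF
    rw [Prod.mk.injEq] at hcW
    have hcol1 : ∀ Z, HasSpectralForm R Z → ∀ j,
        ‖(WithLp.toLp 2 fun i => U Z i j : EuclideanSpace ℂ (Fin n))‖ ≤ 2 := by
      intro Z hZs j
      have h1 : ‖(WithLp.toLp 2 fun i => U Z i j : EuclideanSpace ℂ (Fin n))‖ ^ 2 = 1 := by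
        have h2 := congrArg Complex.re (congrFun (congrFun (hU Z hZs) j) j)
        rw [Matrix.one_apply_eq, Complex.one_re, Matrix.mul_apply, Complex.re_sum] at h2
        rw [EuclideanSpace.norm_sq_eq, ← h2]
        refine Finset.sum_congr rfl fun i _ => ?_
        rw [Matrix.conjTranspose_apply, ← Complex.normSq_eq_norm_sq, Complex.normSq_apply]
        simp
      nlinarith [norm_nonneg (WithLp.toLp 2 fun i => U Z i j : EuclideanSpace ℂ (Fin n))]
    have hd1 : ∀ Z, HasSpectralForm R Z → ‖Z‖ = 1 → ∑ i, d Z i ^ 2 = 1 := by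
      intro Z hZs hZ1
      rw [← norm_sq_conj_diagonal (hU Z hZs), ← hZ Z hZs, hZ1, one_pow]
    have hd2 : ∀ Z, HasSpectralForm R Z → ‖Z‖ = 1 →
        ‖(WithLp.toLp 2 (d Z) : EuclideanSpace ℝ (Fin R))‖ ≤ 2 := by
      intro Z hZs hZ1
      have h1 : ‖(WithLp.toLp 2 (d Z) : EuclideanSpace ℝ (Fin R))‖ ^ 2 = 1 := by
        rw [EuclideanSpace.norm_sq_eq, ← hd1 Z hZs hZ1]
        simp
      nlinarith [norm_nonneg (WithLp.toLp 2 (d Z) : EuclideanSpace ℝ (Fin R))]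
    refine ⟨W, hWF, ?_, ?_⟩
    · conv_lhs => rw [hZ Z hZs, hZ W hWs]
      refine norm_conj_diagonal_sub_le (ε := 4 / 2 ^ t) (hU Z hZs) (hU W hWs) (hd1 Z hZs hZ1)
        (by positivity) (fun j => ?_) ?_
      · have h1 : c₁ (WithLp.toLp 2 fun i => U Z i j) = c₁ (WithLp.toLp 2 fun i => U W i j) :=
          congrFun hcW.1 j
        have h2 := hc₁ _ _ (hcol1 Z hZs j) (hcol1 W hWs j) h1
        rw [← WithLp.toLp_sub] at h2
        exact h2
      · have h1 := hc₂ _ _ (hd2 Z hZs hZ1) (hd2 W hWs hW1) hcW.2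
        have h2 := pow_le_pow_left₀ (norm_nonneg _) h1 2
        rw [EuclideanSpace.norm_sq_eq] at h2
        simpa using h2
    · have h1 : Z - W = Z + (-1 : ℝ) • W := by simp [sub_eq_add_neg]
      rw [h1]
      refine (rank_add_le _ _).trans ?_
      have := hZs.rank_le
      have := (hWs.smul (-1)).rank_le
      omega

end SpectralForm

/-! ### From a net to a restricted isometry. -/

section RestrictedIsometry

open scoped Matrix.Norms.Frobenius

variable {n R : ℕ}

theorem seminorm_le_of_bound_on_normalized (f : Seminorm ℝ (Matrix (Fin n) (Fin n) ℂ)) {B : ℝ}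
    (hB : ∀ Z, HasSpectralForm R Z → ‖Z‖ = 1 → f Z ≤ B) {Z : Matrix (Fin n) (Fin n) ℂ}
    (hZ : HasSpectralForm R Z) : f Z ≤ B * ‖Z‖ := by
  rcases eq_or_ne Z 0 with rfl | h0
  · simp
  · have hpos : 0 < ‖Z‖ := norm_pos_iff.2 h0
    have h1 := hB (‖Z‖⁻¹ • Z) (hZ.smul _) (by
      rw [norm_smul, norm_inv, norm_norm, inv_mul_cancel₀ hpos.ne'])
    rw [map_smul_eq_mul, norm_inv, norm_norm, inv_mul_le_iff₀ hpos] at h1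
    linarith

theorem le_seminorm_of_bound_on_normalized (f : Seminorm ℝ (Matrix (Fin n) (Fin n) ℂ)) {b : ℝ}
    (hb : ∀ Z, HasSpectralForm R Z → ‖Z‖ = 1 → b ≤ f Z) {Z : Matrix (Fin n) (Fin n) ℂ}
    (hZ : HasSpectralForm R Z) : b * ‖Z‖ ≤ f Z := by
  rcases eq_or_ne Z 0 with rfl | h0
  · simp
  · have hpos : 0 < ‖Z‖ := norm_pos_iff.2 h0
    have h1 := hb (‖Z‖⁻¹ • Z) (hZ.smul _) (by
      rw [norm_smul, norm_inv, norm_norm, inv_mul_cancel₀ hpos.ne'])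
    rw [map_smul_eq_mul, norm_inv, norm_norm, le_inv_mul_iff₀ hpos] at h1
    linarith

/-- A seminorm that is controlled on a fine net of the normalized matrices with a spectral form of
length `R` is controlled on all of them. -/
theorem restricted_isometry_of_net (hR : R ≤ n) (f : Seminorm ℝ (Matrix (Fin n) (Fin n) ℂ))
    (hf : ∃ C, ∀ Z, f Z ≤ C * ‖Z‖) {κ : ℝ} (hκ : 0 ≤ κ) (F : Finset (Matrix (Fin n) (Fin n) ℂ))
    (hFS : ∀ W ∈ F, HasSpectralForm R W ∧ ‖W‖ = 1)
    (hF : ∀ Z, HasSpectralForm R Z → ‖Z‖ = 1 →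
      ∃ W ∈ F, ‖Z - W‖ ≤ 1 / 384 ∧ (Z - W).rank ≤ 2 * R)
    (hlow : ∀ W ∈ F, κ / 12 ≤ f W) (hup : ∀ W ∈ F, f W ≤ 4 * κ)
    {Z : Matrix (Fin n) (Fin n) ℂ} (hZ : HasSpectralForm R Z) :
    κ / 24 * ‖Z‖ ≤ f Z ∧ f Z ≤ 8 * κ * ‖Z‖ := by
  set S : Set ℝ := f '' {Z | HasSpectralForm R Z ∧ ‖Z‖ = 1}
  have hbdd : BddAbove S := by
    obtain ⟨C, hC⟩ := hf
    refine ⟨C, ?_⟩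
    rintro _ ⟨Z, ⟨-, hZ1⟩, rfl⟩
    simpa [hZ1] using hC Z
  have hB : ∀ Z, HasSpectralForm R Z → ‖Z‖ = 1 → f Z ≤ sSup S := fun Z hZ hZ1 =>
    le_csSup hbdd ⟨Z, ⟨hZ, hZ1⟩, rfl⟩
  have hB0 : 0 ≤ sSup S := Real.sSup_nonneg (by
    rintro _ ⟨Z, -, rfl⟩
    exact apply_nonneg f Z)
  -- Both summands of `Z - W` have norm at most `1 / 384`, whence `2 / 384 = 1 / 192`.
  have hdiff : ∀ Z, HasSpectralForm R Z → ‖Z‖ = 1 → ∃ W ∈ F, f (Z - W) ≤ sSup S / 192 := by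
    intro Z hZ hZ1
    obtain ⟨W, hW, hZW, hrank⟩ := hF Z hZ hZ1
    obtain ⟨D₁, D₂, h1, h2, hD, hn1, hn2⟩ :=
      exists_add_of_rank_le (hZ.isHermitian.sub (hFS W hW).1.isHermitian) hrank hR
    refine ⟨W, hW, ?_⟩
    rw [hD]
    have h3 := seminorm_le_of_bound_on_normalized f hB h1
    have h4 := seminorm_le_of_bound_on_normalized f hB h2
    have h5 := mul_le_mul_of_nonneg_left (hn1.trans hZW) hB0
    have h6 := mul_le_mul_of_nonneg_left (hn2.trans hZW) hB0
    linarith [map_add_le_add f D₁ D₂]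
  have hB8 : sSup S ≤ 8 * κ := by
    rcases S.eq_empty_or_nonempty with h | h
    · rw [h, Real.sSup_empty]
      positivity
    -- The supremum bounds itself; it is finite by `hf`, so its small multiple can be absorbed.
    · have : sSup S ≤ 4 * κ + sSup S / 192 := by
        apply csSup_le h
        rintro _ ⟨Z, ⟨hZ, hZ1⟩, rfl⟩
        obtain ⟨W, hW, hZW⟩ := hdiff Z hZ hZ1
        have h1 := map_add_le_add f W (Z - W)
        rw [add_sub_cancel] at h1
        linarith [hup W hW]
      linarith
  constructor
  -- The lower constant is `κ / 12 - 8 κ / 192 = κ / 24`.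
  · refine le_seminorm_of_bound_on_normalized f (fun Z hZ hZ1 => ?_) hZ
    obtain ⟨W, hW, hZW⟩ := hdiff Z hZ hZ1
    have h1 := map_sub_le_add f Z (Z - W)
    rw [sub_sub_cancel] at h1
    linarith [hlow W hW]
  · exact seminorm_le_of_bound_on_normalized f (fun Z hZ hZ1 => (hB Z hZ hZ1).trans hB8) hZ

end RestrictedIsometry

/-! ### Decomposition into blocks of consecutive singular values. -/

section Blocks

open scoped Matrix.Norms.Frobenius

variable {n R : ℕ}

/-- The first entry of a block is at most every entry of the block before it. -/
theorem sum_mul_le_sum_range_mul {s : ℕ → ℝ} (hs : Antitone s) (N : ℕ) :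
    ∑ i ∈ Finset.range N, R * s ((i + 1) * R) ≤ ∑ j ∈ Finset.range (N * R), s j := by
  induction N with
  | zero => simp
  | succ N ih =>
    rw [Finset.sum_range_succ, add_mul, one_mul, Finset.sum_range_add]
    refine add_le_add ih ?_
    calc R * s (N * R + R) = ∑ _j ∈ Finset.range R, s (N * R + R) := by simp
      _ ≤ ∑ j ∈ Finset.range R, s (N * R + j) := Finset.sum_le_sum fun j hj => hs (by
          rw [Finset.mem_range] at hj
          omega)

theorem singularValue_eq_zero_of_le (X : Matrix (Fin n) (Fin n) ℂ) {j : ℕ} (h : n ≤ j) :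
    singularValue X j = 0 :=
  singularValue_eq_zero_of_rank_le ((Matrix.rank_le_width X).trans h)

/-- Splitting a Hermitian matrix into blocks of `R` consecutive singular values: under a
restricted isometry property, the first block dominates. -/
theorem exists_head_block (hR1 : 1 ≤ R) (hR : R ≤ n) (f : Seminorm ℝ (Matrix (Fin n) (Fin n) ℂ))
    {α β : ℝ} (hβ : 0 ≤ β)
    (hf : ∀ Z, HasSpectralForm R Z → α * ‖Z‖ ≤ f Z ∧ f Z ≤ β * ‖Z‖)
    {M : Matrix (Fin n) (Fin n) ℂ} (hM : M.IsHermitian) :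
    ∃ h t : ℝ, 0 ≤ h ∧ h ^ 2 = ∑ j ∈ Finset.range R, singularValue M j ^ 2 ∧
      t ≤ nuclearNorm M / √R ∧ (R = n → t = 0) ∧ ‖M‖ ≤ h + t ∧ α * h - β * t ≤ f M := by
  obtain ⟨U, d, hU, hMU, hd⟩ := exists_spectral_decomposition hM
  set s := singularValue M with hs
  have hanti : Antitone s := singularValue_antitone M
  have hs0 : ∀ j, 0 ≤ s j := singularValue_nonneg M
  have hRpos : (0 : ℝ) < R := by exact_mod_cast hR1
  set B : ℕ → Matrix (Fin n) (Fin n) ℂ := fun i =>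
    U * Matrix.diagonal (fun j => ((if j.val / R = i then d j else 0 : ℝ) : ℂ)) * Uᴴ with hB
  have hblock : ∀ i (j : Fin n), j.val / R = i ↔ j.val ∈ Finset.Ico (i * R) (i * R + R) := by
    intro i j
    rw [Nat.div_eq_iff (by omega), Finset.mem_Ico]
    omega
  have hBnorm : ∀ i, ‖B i‖ ^ 2 = ∑ j ∈ Finset.Ico (i * R) (i * R + R), s j ^ 2 := by
    intro i
    rw [hB, norm_sq_conj_diagonal hU]
    have h1 : ∀ j : Fin n, (if j.val / R = i then d j else 0) ^ 2 =
        if j.val ∈ Finset.Ico (i * R) (i * R + R) then s j ^ 2 else 0 := by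
      intro j
      rw [← hd, sq_abs]
      simp only [hblock]
      split_ifs <;> simp
    simp_rw [h1]
    rw [Fin.sum_univ_eq_sum_range
      (fun j => if j ∈ Finset.Ico (i * R) (i * R + R) then s j ^ 2 else 0), ← Finset.sum_filter]
    refine Finset.sum_subset (fun j hj => (Finset.mem_filter.1 hj).2) fun j hj hj' => ?_
    have : n ≤ j := by
      by_contra! h
      exact hj' (Finset.mem_filter.2 ⟨Finset.mem_range.2 h, hj⟩)
    rw [hs, singularValue_eq_zero_of_le M this]
    simp
  have hBform : ∀ i, HasSpectralForm R (B i) := by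
    intro i
    refine hasSpectralForm_of_support hU (s := Finset.univ.filter fun j => j.val / R = i) ?_ hR ?_
    · rw [← Finset.card_map Fin.valEmbedding]
      refine (Finset.card_le_card (t := Finset.Ico (i * R) (i * R + R)) ?_).trans (by simp)
      intro j hj
      simp only [Finset.mem_map, Finset.mem_filter, Finset.mem_univ, true_and] at hj
      obtain ⟨l, hl, rfl⟩ := hj
      exact (hblock i l).1 hl
    · intro j hj
      simp only [Finset.mem_filter, Finset.mem_univ, true_and] at hj
      simp [hj]
  have hBle : ∀ i, ‖B i‖ ≤ √R * s (i * R) := by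
    intro i
    rw [← sq_le_sq₀ (norm_nonneg _) (mul_nonneg (Real.sqrt_nonneg _) (hs0 _)), hBnorm, mul_pow,
      Real.sq_sqrt hRpos.le]
    calc ∑ j ∈ Finset.Ico (i * R) (i * R + R), s j ^ 2
        ≤ ∑ j ∈ Finset.Ico (i * R) (i * R + R), s (i * R) ^ 2 :=
          Finset.sum_le_sum fun j hj =>
            pow_le_pow_left₀ (hs0 _) (hanti (Finset.mem_Ico.1 hj).1) 2
      _ = R * s (i * R) ^ 2 := by simp
  have hsum : M = B 0 + ∑ i ∈ Finset.range n, B (i + 1) := by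
    rw [add_comm, ← Finset.sum_range_succ' B n]
    simp only [hB]
    rw [← Finset.sum_mul, ← Finset.mul_sum]
    conv_lhs => rw [hMU]
    congr 2
    ext a b
    rw [Matrix.sum_apply]
    simp only [Matrix.diagonal_apply]
    split_ifs with hab
    · rw [← Complex.ofReal_sum, Finset.sum_ite_eq, if_pos]
      rw [Finset.mem_range]
      exact (Nat.div_le_self _ _).trans_lt (a.isLt.trans (Nat.lt_succ_self n))
    · simp
  -- Singular values from index `n` on are zero, so `n` tail blocks are more than enough and the
  -- surplus ones vanish.
  set t := ∑ i ∈ Finset.range n, √R * s ((i + 1) * R) with ht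
  have htail : ∑ i ∈ Finset.range n, ‖B (i + 1)‖ ≤ t := Finset.sum_le_sum fun i _ => hBle (i + 1)
  refine ⟨‖B 0‖, t, norm_nonneg _, ?_, ?_, ?_, ?_, ?_⟩
  · rw [hBnorm, zero_mul, zero_add, Finset.range_eq_Ico]
  · have h1 := sum_mul_le_sum_range_mul (R := R) hanti n
    have h2 : ∑ j ∈ Finset.range (n * R), s j = nuclearNorm M := by
      rw [nuclearNorm]
      refine (Finset.sum_subset (Finset.range_mono (Nat.le_mul_of_pos_right n hR1))
        fun j _ hj => ?_).symm
      exact singularValue_eq_zero_of_le M (by simpa using hj)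
    rw [h2, ← Finset.mul_sum] at h1
    rw [le_div_iff₀ (Real.sqrt_pos.2 hRpos), ht, ← Finset.mul_sum, mul_right_comm,
      Real.mul_self_sqrt hRpos.le]
    exact h1
  · rintro rfl
    refine Finset.sum_eq_zero fun i _ => ?_
    rw [hs, singularValue_eq_zero_of_le M (Nat.le_mul_of_pos_left _ (Nat.succ_pos i)), mul_zero]
  · calc ‖M‖ = ‖B 0 + ∑ i ∈ Finset.range n, B (i + 1)‖ := by rw [← hsum]
      _ ≤ ‖B 0‖ + ∑ i ∈ Finset.range n, ‖B (i + 1)‖ :=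
        (norm_add_le _ _).trans (add_le_add_right (norm_sum_le _ _) _)
      _ ≤ ‖B 0‖ + t := add_le_add_right htail _
  · have h1 : f (∑ i ∈ Finset.range n, B (i + 1)) ≤ β * t := by
      refine (Finset.le_sum_of_subadditive f (map_zero f).le (map_add_le_add f) _ _).trans ?_
      refine (Finset.sum_le_sum fun i _ => (hf _ (hBform (i + 1))).2).trans ?_
      rw [← Finset.mul_sum]
      exact mul_le_mul_of_nonneg_left htail hβ
    have h2 := map_sub_le_add f M (∑ i ∈ Finset.range n, B (i + 1))
    have h3 : M - ∑ i ∈ Finset.range n, B (i + 1) = B 0 := by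
      conv_lhs => rw [hsum]
      abel
    rw [h3] at h2
    linarith [(hf _ (hBform 0)).1]

end Blocks

/-! ### The null space dichotomy and deterministic recovery. -/

section Recovery

open scoped Matrix.Norms.Frobenius

variable {n r m : ℕ}

theorem norm_sq_eq_sum_singularValue_sq {M : Matrix (Fin n) (Fin n) ℂ} (hM : M.IsHermitian) :
    ‖M‖ ^ 2 = ∑ j ∈ Finset.range n, singularValue M j ^ 2 := by
  obtain ⟨U, d, hU, hMU, hd⟩ := exists_spectral_decomposition hM
  conv_lhs => rw [hMU]
  rw [norm_sq_conj_diagonal hU, ← Fin.sum_univ_eq_sum_range (fun j => singularValue M j ^ 2)]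
  exact Finset.sum_congr rfl fun j _ => by rw [← hd, sq_abs]

/-- The `ℓ²` norm of the `r` largest singular values. -/
noncomputable def frobeniusHead (r : ℕ) (M : Matrix (Fin n) (Fin n) ℂ) : ℝ :=
  √(∑ j ∈ Finset.range r, singularValue M j ^ 2)

theorem frobeniusHead_sq (M : Matrix (Fin n) (Fin n) ℂ) :
    frobeniusHead r M ^ 2 = ∑ j ∈ Finset.range r, singularValue M j ^ 2 :=
  Real.sq_sqrt (by positivity)

theorem nuclearHead_le (M : Matrix (Fin n) (Fin n) ℂ) :
    nuclearHead r M ≤ √r * frobeniusHead r M := by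
  rw [nuclearHead, frobeniusHead, ← Real.sqrt_mul (Nat.cast_nonneg r)]
  refine Real.le_sqrt_of_sq_le ?_
  simpa using sq_sum_le_card_mul_sum_sq (s := Finset.range r) (f := singularValue M)

/-- Every tail value is at most the one at index `r`, which is at most the root mean square of the
first `r`. -/
theorem norm_sq_le_frobeniusHead (hr : 1 ≤ r) (hrn : r ≤ n) {M : Matrix (Fin n) (Fin n) ℂ}
    (hM : M.IsHermitian) :
    ‖M‖ ^ 2 ≤ frobeniusHead r M * (frobeniusHead r M + nuclearTail r M / √r) := by
  have hanti := singularValue_antitone M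
  have h0 := singularValue_nonneg M
  have hrpos : (0 : ℝ) < √r := Real.sqrt_pos.2 (by exact_mod_cast hr)
  have h1 : singularValue M r ≤ frobeniusHead r M / √r := by
    rw [le_div_iff₀ hrpos]
    refine Real.le_sqrt_of_sq_le ?_
    rw [mul_pow, Real.sq_sqrt (Nat.cast_nonneg r), mul_comm]
    calc (r : ℝ) * singularValue M r ^ 2 = ∑ _j ∈ Finset.range r, singularValue M r ^ 2 := by simp
      _ ≤ _ := Finset.sum_le_sum fun j hj =>
        pow_le_pow_left₀ (h0 _) (hanti (Finset.mem_range.1 hj).le) 2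
  have h2 : ∑ j ∈ Finset.Ico r n, singularValue M j ^ 2 ≤
      frobeniusHead r M / √r * nuclearTail r M := by
    rw [nuclearTail, Finset.mul_sum]
    refine Finset.sum_le_sum fun j hj => ?_
    rw [sq]
    exact mul_le_mul_of_nonneg_right ((hanti (Finset.mem_Ico.1 hj).1).trans h1) (h0 j)
  rw [norm_sq_eq_sum_singularValue_sq hM, ← Finset.sum_range_add_sum_Ico _ hrn,
    ← frobeniusHead_sq, mul_add, ← sq, mul_div_assoc', mul_comm (frobeniusHead r M) (nuclearTail _ _),
    mul_div_assoc, mul_comm (nuclearTail _ _)]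
  exact add_le_add_right h2 _

/-- The stable null space property of order `r`: a Hermitian matrix whose singular values are
concentrated on the `r` largest ones has a large image under the measurement map. -/
def StableNullSpaceProperty (A : Fin m → Matrix (Fin n) (Fin n) ℂ) (r : ℕ) (ρ τ : ℝ) : Prop :=
  ∀ M : Matrix (Fin n) (Fin n) ℂ, M.IsHermitian →
    (nuclearHead r M ≤ ρ * nuclearTail r M ∧ ‖M‖ ≤ (1 + ρ) * (nuclearTail r M / √r)) ∨
      ‖M‖ ≤ τ * ‖measurementMap A M‖

/-- The cases compare the head `g` with `ρ Q`. If `g` is larger, then `‖M‖_* ≤ 2 √r g / ρ`, and the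
size of `R` makes the tail blocks at most `2 g / 768 = g / 384`. Hence `f M ≥ (κ/24 - 8κ/384) h = κ
h / 48`, while `‖M‖ ≤ 2 h`. -/
theorem nullSpace_dichotomy_of_restricted_isometry {R : ℕ} {ρ κ : ℝ} (hr : 1 ≤ r) (hrR : r ≤ R)
    (hRn : R ≤ n) (hρ : 0 < ρ) (hρ1 : ρ < 1) (hκ : 0 < κ)
    (hR : R = n ∨ 768 ^ 2 * (ρ ^ 2)⁻¹ * r ≤ R) (f : Seminorm ℝ (Matrix (Fin n) (Fin n) ℂ))
    (hf : ∀ Z, HasSpectralForm R Z → κ / 24 * ‖Z‖ ≤ f Z ∧ f Z ≤ 8 * κ * ‖Z‖)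
    {M : Matrix (Fin n) (Fin n) ℂ} (hM : M.IsHermitian) :
    (nuclearHead r M ≤ ρ * nuclearTail r M ∧ ‖M‖ ≤ (1 + ρ) * (nuclearTail r M / √r)) ∨
      ‖M‖ ≤ 96 / κ * f M := by
  have hrpos : (0 : ℝ) < √r := Real.sqrt_pos.2 (by exact_mod_cast hr)
  set g := frobeniusHead r M with hg
  set Q := nuclearTail r M / √r with hQ
  have hg0 : 0 ≤ g := Real.sqrt_nonneg _
  have hQ0 : 0 ≤ Q := div_nonneg (nuclearTail_nonneg _ _) hrpos.le
  have hqQ : nuclearTail r M = √r * Q := by rw [hQ]; field_simp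
  have hhead := nuclearHead_le (r := r) M
  rcases le_or_gt g (ρ * Q) with hcase | hcase
  · left
    constructor
    · rw [hqQ]
      refine hhead.trans ?_
      nlinarith
    · have h1 := norm_sq_le_frobeniusHead hr (hrR.trans hRn) hM
      refine le_of_sq_le_sq ?_ (by positivity)
      refine h1.trans ?_
      calc g * (g + Q) ≤ ρ * Q * (ρ * Q + Q) := by gcongr
        _ ≤ ((1 + ρ) * Q) ^ 2 := by nlinarith [mul_nonneg hQ0 hQ0, mul_pos hρ hρ]
  · right
    obtain ⟨h, t, hh0, hh, ht, htn, hMh, hfM⟩ := exists_head_block (hr.trans hrR) hRn f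
      (by positivity : 0 ≤ 8 * κ) hf hM
    have hgh : g ≤ h := by
      refine le_of_sq_le_sq ?_ hh0
      rw [hg, frobeniusHead_sq, hh]
      exact Finset.sum_le_sum_of_subset_of_nonneg (Finset.range_mono hrR)
        fun _ _ _ => sq_nonneg _
    have htg : t ≤ g / 384 := by
      rcases hR with rfl | hR
      · rw [htn rfl]
        positivity
      · refine ht.trans ?_
        have hRpos : (0 : ℝ) < √R := Real.sqrt_pos.2 (by exact_mod_cast hr.trans hrR)
        have hsqrt : 768 * √r ≤ ρ * √R := by
          refine le_of_sq_le_sq ?_ (by positivity)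
          rw [mul_pow, mul_pow, Real.sq_sqrt (Nat.cast_nonneg _), Real.sq_sqrt (Nat.cast_nonneg _)]
          rw [mul_right_comm, ← div_eq_mul_inv, div_le_iff₀ (by positivity)] at hR
          linarith
        rw [div_le_iff₀ hRpos, ← nuclearHead_add_nuclearTail (hrR.trans hRn), hqQ]
        have h1 : ρ * (nuclearHead r M + √r * Q) ≤ 2 * √r * g := by
          have h2 : ρ * nuclearHead r M ≤ 1 * (√r * g) :=
            mul_le_mul hρ1.le hhead (Finset.sum_nonneg fun _ _ => singularValue_nonneg M _)
              zero_le_one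
          nlinarith
        have h3 : 2 * √r * g ≤ ρ * (g / 384 * √R) := by nlinarith
        exact le_of_mul_le_mul_left (h1.trans h3) hρ
    have h1 : ‖M‖ ≤ 2 * h := by linarith
    have h2 : κ / 48 * h ≤ f M := by nlinarith
    rw [div_mul_eq_mul_div, le_div_iff₀ hκ]
    nlinarith

theorem measurementMap_sub (A : Fin m → Matrix (Fin n) (Fin n) ℂ) (X Y : Matrix (Fin n) (Fin n) ℂ) :
    measurementMap A (X - Y) = measurementMap A X - measurementMap A Y := by
  ext j
  simp [measurementMap, sub_mul, Matrix.trace_sub]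

/-- In the first alternative, optimality and the Lipschitz estimate give `(1 - ρ) · tail (X - Z) ≤ 2
· tail X`; in the second, both points are feasible, so the measurements differ by at most `2 η`.
Each alternative needs only one of the two terms, and the stated constants leave slack. -/
theorem StableNullSpaceProperty.frobeniusNorm_sub_le {A : Fin m → Matrix (Fin n) (Fin n) ℂ}
    {ρ τ : ℝ} (hA : StableNullSpaceProperty A r ρ τ) (hτ : 0 ≤ τ) (hr : 1 ≤ r) (hrn : r ≤ n)
    (hρ : 0 < ρ) (hρ1 : ρ < 1) {X Z : Matrix (Fin n) (Fin n) ℂ} (hX : X.IsHermitian) {η : ℝ}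
    {ε : EuclideanSpace ℂ (Fin m)} (hε : ‖ε‖ ≤ η) (hZ : IsMinimizer A (measurementMap A X + ε) η Z) :
    frobeniusNorm (X - Z) ≤ 2 * (1 + ρ) ^ 2 / ((1 - ρ) * √(r : ℝ)) * nuclearTail r X +
      (3 + ρ) / (1 - ρ) * (2 * τ * η) := by
  have hrpos : (0 : ℝ) < √r := Real.sqrt_pos.2 (by exact_mod_cast hr)
  have hη : 0 ≤ η := (norm_nonneg ε).trans hε
  have h1ρ : 0 < 1 - ρ := by linarith
  have htail := nuclearTail_nonneg r X
  rw [frobeniusNorm_eq_norm]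
  rcases hA (X - Z) (hX.sub hZ.isHermitian) with ⟨h1, h2⟩ | h1
  · have h3 := nuclearTail_sub_nuclearHead_sub_le hX hZ.isHermitian hrn
    have h4 := hZ.minimal X hX (by simpa using hε)
    rw [← nuclearHead_add_nuclearTail hrn X] at h4
    have h5 : nuclearTail r (X - Z) ≤ 2 * nuclearTail r X / (1 - ρ) := by
      rw [le_div_iff₀ h1ρ]
      linarith
    have h6 : ‖X - Z‖ ≤ 2 * (1 + ρ) ^ 2 / ((1 - ρ) * √(r : ℝ)) * nuclearTail r X := by
      calc ‖X - Z‖ ≤ (1 + ρ) * (nuclearTail r (X - Z) / √r) := h2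
        _ ≤ (1 + ρ) * (2 * nuclearTail r X / (1 - ρ) / √r) := by gcongr
        _ = 2 * (1 + ρ) / ((1 - ρ) * √r) * nuclearTail r X := by field_simp
        _ ≤ _ := by
          gcongr
          nlinarith
    have : 0 ≤ (3 + ρ) / (1 - ρ) * (2 * τ * η) := by positivity
    linarith
  · have h2 : ‖measurementMap A (X - Z)‖ ≤ 2 * η := by
      have h3 : measurementMap A (X - Z) = (measurementMap A X + ε - measurementMap A Z) - ε := by
        rw [measurementMap_sub]
        abel
      have h4 := hZ.feasible
      rw [norm_sub_rev] at h4
      rw [h3]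
      linarith [norm_sub_le (measurementMap A X + ε - measurementMap A Z) ε]
    have h5 : ‖X - Z‖ ≤ 1 * (2 * τ * η) := by
      refine h1.trans ?_
      nlinarith
    have h6 : 1 ≤ (3 + ρ) / (1 - ρ) := by
      rw [le_div_iff₀ h1ρ]
      linarith
    have h7 : 1 * (2 * τ * η) ≤ (3 + ρ) / (1 - ρ) * (2 * τ * η) := by gcongr
    have : 0 ≤ 2 * (1 + ρ) ^ 2 / ((1 - ρ) * √(r : ℝ)) * nuclearTail r X := by positivity
    linarith

theorem StableNullSpaceProperty.isMinimizer_iff {A : Fin m → Matrix (Fin n) (Fin n) ℂ}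
    {ρ τ : ℝ} (hA : StableNullSpaceProperty A r ρ τ) (hτ : 0 ≤ τ) (hr : 1 ≤ r) (hrn : r ≤ n)
    (hρ : 0 < ρ) (hρ1 : ρ < 1) {X : Matrix (Fin n) (Fin n) ℂ} (hX : X.IsHermitian)
    (hrank : X.rank ≤ r) (Z : Matrix (Fin n) (Fin n) ℂ) :
    IsMinimizer A (measurementMap A X) 0 Z ↔ Z = X := by
  have htail : nuclearTail r X = 0 := Finset.sum_eq_zero fun j hj =>
    singularValue_eq_zero_of_rank_le (hrank.trans (Finset.mem_Ico.1 hj).1)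
  constructor
  · intro hZ
    have h := hA.frobeniusNorm_sub_le hτ hr hrn hρ hρ1 hX (ε := 0) (η := 0) (by simp)
      (by simpa using hZ)
    rw [htail, frobeniusNorm_eq_norm] at h
    simp only [mul_zero, add_zero] at h
    exact (sub_eq_zero.1 (norm_le_zero_iff.1 h)).symm
  · rintro rfl
    refine ⟨hX, by simp, fun W hW hWf => ?_⟩
    have h0 : measurementMap A (Z - W) = 0 := by
      rw [measurementMap_sub, ← neg_sub, neg_eq_zero]
      exact norm_le_zero_iff.1 hWf
    -- With zero tail, the Lipschitz estimate reads `tail (Z - W) - head (Z - W) ≤ ‖W‖_* - ‖Z‖_*`,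
    -- and the left side is nonnegative in the first alternative.
    rcases hA (Z - W) (hX.sub hW) with ⟨h1, -⟩ | h1
    · have h2 := nuclearTail_sub_nuclearHead_sub_le hX hW hrn
      have h3 := nuclearHead_add_nuclearTail hrn Z
      have h4 := nuclearTail_nonneg r (Z - W)
      nlinarith
    · rw [h0, norm_zero, mul_zero] at h1
      rw [sub_eq_zero.1 (norm_le_zero_iff.1 h1)]

end Recovery

/-! ### Paired measurements: probability bounds and comparison with the measurement map. -/

section PairedMeasurements

open scoped Matrix.Norms.Frobenius

variable {n k m : ℕ}

theorem quadForm_add (Z W : Matrix (Fin n) (Fin n) ℂ) (a : Fin n → ℂ) :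
    quadForm (Z + W) a = quadForm Z a + quadForm W a := by
  simp [quadForm, Matrix.add_mulVec]

theorem quadForm_smul (c : ℝ) (Z : Matrix (Fin n) (Fin n) ℂ) (a : Fin n → ℂ) :
    quadForm (c • Z) a = c * quadForm Z a := by
  simp [quadForm, Matrix.smul_mulVec, dotProduct_smul]

/-- The real linear map `Z ↦ x^* Z x - y^* Z y` (real part). -/
noncomputable def quadDiffLinear (p : (Fin n → ℂ) × (Fin n → ℂ)) :
    Matrix (Fin n) (Fin n) ℂ →ₗ[ℝ] ℝ where
  toFun Z := quadDiff Z p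
  map_add' Z W := by
    simp only [quadDiff, quadForm_add]
    ring
  map_smul' c Z := by
    simp only [quadDiff, quadForm_smul, RingHom.id_apply, smul_eq_mul]
    ring

/-- The `ℓ¹` norm of the paired measurements of a matrix. -/
noncomputable def pairSeminorm (p : Fin k → (Fin n → ℂ) × (Fin n → ℂ)) :
    Seminorm ℝ (Matrix (Fin n) (Fin n) ℂ) :=
  Seminorm.of (fun Z => ∑ j, |quadDiff Z (p j)|)
    (fun Z W => by
      rw [← Finset.sum_add_distrib]
      refine Finset.sum_le_sum fun j _ => ?_
      rw [show quadDiff (Z + W) (p j) = _ from (quadDiffLinear (p j)).map_add Z W]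
      exact abs_add_le _ _)
    (fun c Z => by
      rw [Finset.mul_sum]
      refine Finset.sum_congr rfl fun j _ => ?_
      rw [show quadDiff (c • Z) (p j) = _ from (quadDiffLinear (p j)).map_smul c Z, smul_eq_mul,
        abs_mul]
      rfl)

theorem pairSeminorm_apply (p : Fin k → (Fin n → ℂ) × (Fin n → ℂ))
    (Z : Matrix (Fin n) (Fin n) ℂ) : pairSeminorm p Z = ∑ j, |quadDiff Z (p j)| := rfl

theorem exists_bound_of_finiteDimensional {E : Type*} [NormedAddCommGroup E] [NormedSpace ℝ E]
    [FiniteDimensional ℝ E] (g : E →ₗ[ℝ] ℝ) : ∃ C, ∀ x, |g x| ≤ C * ‖x‖ :=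
  ⟨‖g.toContinuousLinearMap‖, g.toContinuousLinearMap.le_opNorm⟩

theorem exists_pairSeminorm_le (p : Fin k → (Fin n → ℂ) × (Fin n → ℂ)) :
    ∃ C, ∀ Z, pairSeminorm p Z ≤ C * ‖Z‖ := by
  choose C hC using fun j => exists_bound_of_finiteDimensional (quadDiffLinear (p j))
  refine ⟨∑ j, C j, fun Z => ?_⟩
  rw [pairSeminorm_apply, Finset.sum_mul]
  exact Finset.sum_le_sum fun j _ => hC j Z

theorem measureReal_pairSeminorm_bad_le {W : Matrix (Fin n) (Fin n) ℂ} (hW : W.IsHermitian)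
    (hW1 : ‖W‖ = 1) :
    (Measure.pi fun _ : Fin k => gaussianPair n).real
      {p | ¬ ((k : ℝ) / 12 ≤ pairSeminorm p W ∧ pairSeminorm p W ≤ 4 * k)} ≤
      2 * Real.exp (-(k / 12)) := by
  obtain ⟨U, d, hU, rfl, -⟩ := exists_spectral_decomposition hW
  have hd : ∑ i, d i ^ 2 = 1 := by
    rw [← norm_sq_conj_diagonal hU, hW1, one_pow]
  have h1 := measureReal_sum_abs_quadDiff_ge k hU hd
  have h2 := measureReal_sum_abs_quadDiff_le k hU hd
  have h3 : Real.exp (-(k : ℝ)) ≤ Real.exp (-(k / 12)) := by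
    have : (0 : ℝ) ≤ k := Nat.cast_nonneg k
    exact Real.exp_le_exp.2 (by linarith)
  refine (measureReal_mono (s₂ := {p | _} ∪ {p | _}) ?_ (measure_ne_top _ _)).trans
    ((measureReal_union_le _ _).trans ((add_le_add h1 h2).trans (by linarith)))
  intro p hp
  rw [Set.mem_ofPred_eq, not_and_or, not_le, not_le] at hp
  rcases hp with h | h
  · exact Or.inr h.le
  · exact Or.inl h.le

theorem measureReal_exists_bad_le (F : Finset (Matrix (Fin n) (Fin n) ℂ))
    (hF : ∀ W ∈ F, W.IsHermitian ∧ ‖W‖ = 1) :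
    (Measure.pi fun _ : Fin k => gaussianPair n).real
      {p | ∃ W ∈ F, ¬ ((k : ℝ) / 12 ≤ pairSeminorm p W ∧ pairSeminorm p W ≤ 4 * k)} ≤
      F.card * (2 * Real.exp (-(k / 12))) := by
  have h1 : {p : Fin k → (Fin n → ℂ) × (Fin n → ℂ) | ∃ W ∈ F,
      ¬ ((k : ℝ) / 12 ≤ pairSeminorm p W ∧ pairSeminorm p W ≤ 4 * k)} =
      ⋃ W ∈ F, {p | ¬ ((k : ℝ) / 12 ≤ pairSeminorm p W ∧ pairSeminorm p W ≤ 4 * k)} := by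
    ext p
    simp
  rw [h1, ← nsmul_eq_mul, ← Finset.sum_const]
  exact (measureReal_biUnion_finset_le _ _).trans
    (Finset.sum_le_sum fun W hW => measureReal_pairSeminorm_bad_le (hF W hW).1 (hF W hW).2)

/-- An injection of two copies of the first half of `Fin m` into `Fin m`. -/
def halves (m : ℕ) : Fin (m / 2) ⊕ Fin (m / 2) → Fin m :=
  Sum.elim (fun j => ⟨j, by omega⟩) (fun j => ⟨j + m / 2, by omega⟩)

theorem halves_injective (m : ℕ) : Function.Injective (halves m) := by
  rintro (⟨i, hi⟩ | ⟨i, hi⟩) (⟨j, hj⟩ | ⟨j, hj⟩) h <;> simp [halves] at h ⊢ <;> omega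

/-- Pairing the vectors of the first half with those of the second half. -/
def pairing (a : Fin m → Fin n → ℂ) : Fin (m / 2) → (Fin n → ℂ) × (Fin n → ℂ) :=
  fun j => (a (halves m (Sum.inl j)), a (halves m (Sum.inr j)))

theorem map_pairing {Ω : Type*} [MeasurableSpace Ω] {P : Measure Ω} [IsProbabilityMeasure P]
    {a : Fin m → Ω → Fin n → ℂ} (ha : ∀ j, HasLaw (a j) (stdComplexGaussianVector n) P)
    (hind : iIndepFun a P) :
    P.map (fun ω => pairing fun j => a j ω) =
      Measure.pi fun _ : Fin (m / 2) => gaussianPair n := by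
  have hpre := hind.precomp (halves_injective m)
  rw [iIndepFun_iff_map_fun_eq_pi_map fun s => (ha _).aemeasurable] at hpre
  simp_rw [(ha _).map_eq] at hpre
  have h1 := measurePreserving_sumPiEquivProdPi
    (fun _ : Fin (m / 2) ⊕ Fin (m / 2) => stdComplexGaussianVector n)
  have h2 := (measurePreserving_arrowProdEquivProdArrow (Fin n → ℂ) (Fin n → ℂ) (Fin (m / 2))
    (fun _ => stdComplexGaussianVector n) (fun _ => stdComplexGaussianVector n)).symm
  have h3 := h2.comp h1
  rw [gaussianPair, ← h3.map_eq, ← hpre, AEMeasurable.map_map_of_aemeasurable]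
  · rfl
  · exact h3.measurable.aemeasurable
  · exact aemeasurable_pi_lambda _ fun s => (ha _).aemeasurable

theorem trace_mul_rankOne_conjTranspose (Z : Matrix (Fin n) (Fin n) ℂ) (a : Fin n → ℂ) :
    (Z * (rankOne a)ᴴ).trace = star a ⬝ᵥ Z *ᵥ a := by
  rw [rankOne, Matrix.conjTranspose_vecMulVec, star_star, Matrix.mul_vecMulVec,
    Matrix.trace_vecMulVec, dotProduct_comm]

/-- Triangle inequality, then Cauchy–Schwarz over the `m` measurements. For odd `m` the unpaired one
is harmless, as it only enlarges the right side. -/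
theorem pairSeminorm_pairing_le (a : Fin m → Fin n → ℂ) (Z : Matrix (Fin n) (Fin n) ℂ) :
    pairSeminorm (pairing a) Z ≤ √m * ‖measurementMap (fun j => rankOne (a j)) Z‖ := by
  have h1 : pairSeminorm (pairing a) Z ≤ ∑ s, |quadForm Z (a (halves m s))| := by
    rw [pairSeminorm_apply, Fintype.sum_sum_type, ← Finset.sum_add_distrib]
    exact Finset.sum_le_sum fun j _ => abs_sub _ _
  have h2 : ∑ s, |quadForm Z (a (halves m s))| ≤ ∑ i, |quadForm Z (a i)| := by
    refine (Finset.sum_map Finset.univ ⟨halves m, halves_injective m⟩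
      fun i => |quadForm Z (a i)|).symm.trans_le ?_
    exact Finset.sum_le_sum_of_subset_of_nonneg (Finset.subset_univ _) fun _ _ _ => abs_nonneg _
  have h3 : ∑ i, |quadForm Z (a i)| ≤
      ∑ i, ‖measurementMap (fun j => rankOne (a j)) Z i‖ := by
    refine Finset.sum_le_sum fun i _ => ?_
    simp only [measurementMap, trace_mul_rankOne_conjTranspose]
    exact Complex.abs_re_le_norm _
  refine h1.trans (h2.trans (h3.trans ?_))
  rw [EuclideanSpace.norm_eq, ← Real.sqrt_mul (Nat.cast_nonneg m)]
  refine Real.le_sqrt_of_sq_le ?_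
  simpa using sq_sum_le_card_mul_sum_sq (s := Finset.univ)
    (f := fun i => ‖measurementMap (fun j => rankOne (a j)) Z i‖)

end PairedMeasurements

/-! ### Choice of constants and the high-probability event. -/

section Main

open scoped Matrix.Norms.Frobenius

theorem exists_block_length {n r : ℕ} {ρ : ℝ} (hr : 1 ≤ r) (hrn : r ≤ n) (hρ : 0 < ρ)
    (hρ1 : ρ < 1) :
    ∃ R : ℕ, r ≤ R ∧ R ≤ n ∧ (R = n ∨ 768 ^ 2 * (ρ ^ 2)⁻¹ * r ≤ R) ∧
      (R : ℝ) ≤ (768 ^ 2 + 1) * ((ρ ^ 2)⁻¹ * r) := by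
  have hinv : 1 ≤ (ρ ^ 2)⁻¹ := (one_le_inv₀ (by positivity)).2 (by nlinarith)
  have hr1 : (1 : ℝ) ≤ r := by exact_mod_cast hr
  have hx : (r : ℝ) ≤ (ρ ^ 2)⁻¹ * r := by nlinarith
  have hceil := Nat.ceil_lt_add_one (a := 768 ^ 2 * (ρ ^ 2)⁻¹ * r) (by positivity)
  have hle := Nat.le_ceil (768 ^ 2 * (ρ ^ 2)⁻¹ * r)
  set N := ⌈768 ^ 2 * (ρ ^ 2)⁻¹ * r⌉₊
  have hrN : r ≤ N := by
    have : (r : ℝ) ≤ N := by nlinarith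
    exact_mod_cast this
  refine ⟨min n N, le_min hrn hrN, min_le_left _ _, ?_, ?_⟩
  · rcases le_total n N with h | h
    · exact Or.inl (min_eq_left h)
    · rw [min_eq_right h]
      exact Or.inr hle
  · have : ((min n N : ℕ) : ℝ) ≤ N := by exact_mod_cast min_le_right n N
    nlinarith

/-- From `5 ≤ e²` the net has at most `exp (78 n R)` points, since `2 · 13 · 3 = 78`, and `2 ≤ e`
adds 1 to the exponent. As `m / 2 ≥ m / 3` after rounding down, the decay is at least `m / 36`; half
of it absorbs the union bound and `m / 72` remains. -/
theorem card_mul_exp_le {n r m R c : ℕ} {ρ : ℝ} (hr : 1 ≤ r) (hn : 1 ≤ n) (hρ : 0 < ρ)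
    (hρ1 : ρ < 1) (hR : (R : ℝ) ≤ (768 ^ 2 + 1) * ((ρ ^ 2)⁻¹ * r))
    (hm : 72 * 79 * (768 ^ 2 + 1) * (ρ ^ 2)⁻¹ * n * r ≤ (m : ℝ))
    (hc : c ≤ (5 ^ 13) ^ (3 * n * R)) :
    (m : ℝ) / 3 ≤ (m / 2 : ℕ) ∧
      c * (2 * Real.exp (-((m / 2 : ℕ) / 12))) ≤ Real.exp (-(1 / 72 * m)) := by
  have hinv : 1 ≤ (ρ ^ 2)⁻¹ := (one_le_inv₀ (by positivity)).2 (by nlinarith)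
  have hr1 : (1 : ℝ) ≤ r := by exact_mod_cast hr
  have hn1 : (1 : ℝ) ≤ n := by exact_mod_cast hn
  have hx1 : 1 ≤ (ρ ^ 2)⁻¹ * n * r := one_le_mul_of_one_le_of_one_le
    (one_le_mul_of_one_le_of_one_le hinv hn1) hr1
  set x := (ρ ^ 2)⁻¹ * n * r with hx
  have hmx : 72 * 79 * (768 ^ 2 + 1) * x ≤ m := by
    rw [hx]
    linarith
  have hnR : (n : ℝ) * R ≤ (768 ^ 2 + 1) * x := by
    have := mul_le_mul_of_nonneg_left hR (by linarith : (0 : ℝ) ≤ n)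
    rw [hx]
    linarith
  have hk : (m : ℝ) / 3 ≤ (m / 2 : ℕ) := by
    have h1 : (3 : ℝ) ≤ m := by linarith
    have h2 : 3 ≤ m := by exact_mod_cast h1
    have h3 : m ≤ 3 * (m / 2) := by omega
    have h4 : (m : ℝ) ≤ 3 * (m / 2 : ℕ) := by exact_mod_cast h3
    linarith
  refine ⟨hk, ?_⟩
  have he := Real.exp_one_gt_d9
  have h5 : (5 : ℝ) ≤ Real.exp 2 := by
    rw [show (2 : ℝ) = 1 + 1 by norm_num, Real.exp_add]
    nlinarith
  have hcard : (c : ℝ) ≤ Real.exp (78 * (n * R)) := by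
    calc (c : ℝ) ≤ ((5 : ℝ) ^ 13) ^ (3 * n * R) := by exact_mod_cast hc
      _ ≤ (Real.exp 2 ^ 13) ^ (3 * n * R) := by gcongr
      _ = Real.exp (78 * (n * R)) := by
        rw [← pow_mul, ← Real.exp_nat_mul]
        congr 1
        push_cast
        ring
  calc c * (2 * Real.exp (-((m / 2 : ℕ) / 12)))
      ≤ Real.exp (78 * (n * R)) * (Real.exp 1 * Real.exp (-((m / 2 : ℕ) / 12))) := by
        gcongr
        linarith
    _ = Real.exp (78 * (n * R) + (1 + -((m / 2 : ℕ) / 12))) := by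
        rw [Real.exp_add, Real.exp_add]
    _ ≤ Real.exp (-(1 / 72 * m)) := Real.exp_le_exp.2 (by linarith)

/-- Gaussian rank-one measurements satisfy the stable null space property with high probability. -/
theorem exists_event_stableNullSpaceProperty {n r m : ℕ} {ρ : ℝ} (hr : 1 ≤ r) (hrn : r ≤ n)
    (hρ : 0 < ρ) (hρ1 : ρ < 1)
    (hm : 72 * 79 * (768 ^ 2 + 1) * (ρ ^ 2)⁻¹ * n * r ≤ (m : ℝ))
    {Ω : Type*} [MeasurableSpace Ω] (P : Measure Ω) [IsProbabilityMeasure P]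
    {a : Fin m → Ω → Fin n → ℂ} (ha : ∀ j, HasLaw (a j) (stdComplexGaussianVector n) P)
    (hind : iIndepFun a P) :
    ∃ E : Set Ω, MeasurableSet E ∧ 1 - Real.exp (-(1 / 72 * m)) ≤ P.real E ∧
      ∀ ω ∈ E, StableNullSpaceProperty (fun j => rankOne (a j ω)) r ρ (288 / √m) := by
  have hn : 1 ≤ n := hr.trans hrn
  obtain ⟨R, hrR, hRn, hR, hRle⟩ := exists_block_length hr hrn hρ hρ1
  obtain ⟨F, hFcard, hFS, hF⟩ := exists_net hn R 13
  obtain ⟨hk, hexp⟩ := card_mul_exp_le hr hn hρ hρ1 hRle hm hFcard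
  set k := m / 2 with hkdef
  set T : Ω → Fin k → (Fin n → ℂ) × (Fin n → ℂ) := fun ω => pairing fun j => a j ω with hT
  set bad : Set (Fin k → (Fin n → ℂ) × (Fin n → ℂ)) := {p | ∃ W ∈ F,
    ¬ ((k : ℝ) / 12 ≤ pairSeminorm p W ∧ pairSeminorm p W ≤ 4 * k)} with hbad
  have hTm : P.map T = Measure.pi fun _ : Fin k => gaussianPair n := map_pairing ha hind
  have hTae : AEMeasurable T P := by
    refine aemeasurable_pi_lambda _ fun j => ?_
    exact (ha _).aemeasurable.prodMk (ha _).aemeasurable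
  -- The vectors are only almost everywhere measurable, so the bad event is replaced by a measurable
  -- hull of the same measure.
  have hprob : P.real (toMeasurable P (T ⁻¹' bad)) ≤ Real.exp (-(1 / 72 * m)) := by
    rw [measureReal_def, measure_toMeasurable]
    calc (P (T ⁻¹' bad)).toReal ≤ ((P.map T) bad).toReal :=
          ENNReal.toReal_mono (by rw [hTm]; exact measure_ne_top _ _)
            (Measure.le_map_apply hTae bad)
      _ = (Measure.pi fun _ : Fin k => gaussianPair n).real bad := by rw [hTm]; rfl
      _ ≤ F.card * (2 * Real.exp (-(k / 12))) :=
          measureReal_exists_bad_le F fun W hW => ⟨(hFS W hW).1.isHermitian, (hFS W hW).2⟩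
      _ ≤ _ := hexp
  refine ⟨(toMeasurable P (T ⁻¹' bad))ᶜ, (measurableSet_toMeasurable _ _).compl, ?_, ?_⟩
  · rw [probReal_compl_eq_one_sub (measurableSet_toMeasurable _ _)]
    linarith
  · intro ω hω M hM
    have hω' : ∀ W ∈ F, (k : ℝ) / 12 ≤ pairSeminorm (T ω) W ∧ pairSeminorm (T ω) W ≤ 4 * k :=
      fun W hW => not_not.1 fun h => hω (subset_toMeasurable P (T ⁻¹' bad) ⟨W, hW, h⟩)
    have hmpos : (0 : ℝ) < m := by
      have hr1 : (0 : ℝ) < r := by exact_mod_cast hr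
      have hn1 : (0 : ℝ) < n := by exact_mod_cast hn
      refine lt_of_lt_of_le ?_ hm
      positivity
    have hkpos : (0 : ℝ) < k := by linarith
    have hrip : ∀ Z, HasSpectralForm R Z → (k : ℝ) / 24 * ‖Z‖ ≤ pairSeminorm (T ω) Z ∧
        pairSeminorm (T ω) Z ≤ 8 * k * ‖Z‖ := fun Z hZ =>
      restricted_isometry_of_net hRn (pairSeminorm (T ω)) (exists_pairSeminorm_le _) hkpos.le F hFS
        (fun Z hZ hZ1 => by
          obtain ⟨W, hW, h1, h2⟩ := hF Z hZ hZ1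
          exact ⟨W, hW, h1.trans (by norm_num), h2⟩)
        (fun W hW => (hω' W hW).1) (fun W hW => (hω' W hW).2) hZ
    refine (nullSpace_dichotomy_of_restricted_isometry hr hrR hRn hρ hρ1 hkpos hR _ hrip hM).imp
      id fun h => h.trans ?_
    have hsq : 0 < √(m : ℝ) := Real.sqrt_pos.2 hmpos
    -- This uses `k ≥ m / 3`, and `288 = 3 · 96`.
    have hc : 96 / (k : ℝ) * √m ≤ 288 / √m := by
      rw [div_mul_eq_mul_div, div_le_div_iff₀ hkpos hsq, mul_assoc, Real.mul_self_sqrt hmpos.le]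
      linarith
    calc 96 / (k : ℝ) * pairSeminorm (T ω) M
        ≤ 96 / (k : ℝ) * (√m * ‖measurementMap (fun j => rankOne (a j ω)) M‖) := by
          gcongr
          exact pairSeminorm_pairing_le (fun j => a j ω) M
      _ = 96 / (k : ℝ) * √m * ‖measurementMap (fun j => rankOne (a j ω)) M‖ := by ring
      _ ≤ _ := by gcongr

end Main

end LowRankRecovery

theorem theorem2 :
    ∃ C₁ C₂ C₃ : ℝ, 0 < C₁ ∧ 0 < C₂ ∧ 0 < C₃ ∧
      ∀ (n r m : ℕ) (ρ : ℝ), 1 ≤ r → r ≤ n → 0 < ρ → ρ < 1 →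
        C₁ * (ρ ^ 2)⁻¹ * (n : ℝ) * (r : ℝ) ≤ (m : ℝ) →
        ∀ (Ω : Type*) [MeasurableSpace Ω] (P : Measure Ω) [IsProbabilityMeasure P]
          (a : Fin m → Ω → (Fin n → ℂ)),
          (∀ j, HasLaw (a j) (stdComplexGaussianVector n) P) → iIndepFun a P →
          ∃ E : Set Ω, MeasurableSet E ∧ 1 - Real.exp (-(C₂ * (m : ℝ))) ≤ P.real E ∧
            ∀ ω ∈ E, ∀ X : Matrix (Fin n) (Fin n) ℂ, X.IsHermitian →
              (∀ (η : ℝ) (ε : EuclideanSpace ℂ (Fin m)), ‖ε‖ ≤ η →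
                ∀ Z : Matrix (Fin n) (Fin n) ℂ,
                  IsMinimizer (fun j => rankOne (a j ω))
                    (measurementMap (fun j => rankOne (a j ω)) X + ε) η Z →
                  frobeniusNorm (X - Z) ≤
                    2 * (1 + ρ) ^ 2 / ((1 - ρ) * √(r : ℝ)) * nuclearTail r X
                      + (3 + ρ) * C₃ / (1 - ρ) * (η / √(m : ℝ))) ∧
              (X.rank ≤ r → ∀ Z : Matrix (Fin n) (Fin n) ℂ,
                IsMinimizer (fun j => rankOne (a j ω))
                  (measurementMap (fun j => rankOne (a j ω)) X) 0 Z ↔ Z = X) := by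
  -- `576 = 2 · 288` comes from the factor `2 * τ` in the recovery bound with `τ = 288 / √m`.
  refine ⟨72 * 79 * (768 ^ 2 + 1), 1 / 72, 576, by norm_num, by norm_num, by norm_num, ?_⟩
  intro n r m ρ hr hrn hρ hρ1 hm Ω _ P _ a ha hind
  obtain ⟨E, hE, hPE, hnsp⟩ := exists_event_stableNullSpaceProperty hr hrn hρ hρ1 hm P ha hind
  refine ⟨E, hE, hPE, fun ω hω X hX => ⟨fun η ε hε Z hZ => ?_, fun hrank Z => ?_⟩⟩
  · refine ((hnsp ω hω).frobeniusNorm_sub_le (by positivity) hr hrn hρ hρ1 hX hε hZ).trans_eq ?_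
    ring
  · exact (hnsp ω hω).isMinimizer_iff (by positivity) hr hrn hρ hρ1 hX hrank Z
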